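/- Let $(M,g)$ be a smooth Lorentzian manifold of dimension $n+2$ ($n\ge 0$) with Levi-Civita connection $\nabla$, and let $i:L\hookrightarrow M$ be a lightlike hypersurface, i.e. an (injectively immersed) hypersurface on which the induced tensor $i^*g$ is degenerate at every point. Let $\zeta$ be a closed rigging for $L$: a smooth vector field on an open set containing $L$ with $\zeta_p\notin T_pL$ for every $p\in L$, whose metrically equivalent $1$-form $\alpha=g(\zeta,\cdot)$ satisfies $d\alpha=0$. Put $\omega=i^*\alpha$ and $\widetilde g=i^*(g+\alpha\otimes\alpha)$ (a Riemannian metric on $L$), with Levi-Civita connection $\widetilde\nabla$; let the rigged vector field $\xi\in\mathfrak X(L)$ be defined by $\widetilde g(\xi,\cdot)=\omega$, let $SL(\zeta)=TL\cap\zeta^{\perp}=\ker\omega$ be the screen distribution (which is integrable), and let $N=\zeta-\tfrac12 g(\zeta,\zeta)\,\xi$ along $L$. The second fundamental form $B$ of $L$ is defined by the decomposition $\nabla_UV=\nabla^L_UV+B(U,V)N$ with $\nabla^L_UV$ tangent to $L$, for $U,V\in\mathfrak X(L)$. One says that $L$ is totally geodesic if $B\equiv 0$, and totally umbilic if $B=\rho\,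 g$ for some $\rho\in C^\infty(L)$. A leaf of $SL(\zeta)$ is a maximal connected integral manifold $S$ of $SL(\zeta)$; with $\widetilde{\mathbb I}(X,Y)$ the $\widetilde g$-normal component of $\widetilde\nabla_XY$ for $X,Y\in\mathfrak X(S)$, it is totally geodesic in $(L,\widetilde g)$ if $\widetilde{\mathbb I}\equiv0$, and totally umbilic if $\widetilde{\mathbb I}(X,Y)=\widetilde g(X,Y)Z$ for some smooth normal vector field $Z$ along $S$. Then: 1. $L$ is totally geodesic if and only if $\xi$ is $\widetilde g$-parallel, i.e. $\widetilde\nabla\xi=0$. 2. $L$ is totally geodesic (respectively totally umbilic) if and only if each leaf of $SL(\zeta)$ is totally geodesic (respectively totally umbilic) as a hypersurface of $(L,\widetilde g)$. -/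

import Mathlib

open scoped Manifold ContDiff

noncomputable section

namespace LightlikeRigging

universe u v

/-- A field of (continuous) bilinear forms on the tangent spaces of a manifold `M`
modelled on `E`. -/
abbrev BilinField (E : Type*) [NormedAddCommGroup E] [NormedSpace ℝ E] (M : Type*)
    [TopologicalSpace M] [ChartedSpace E M] : Type _ :=
  ∀ x : M, TangentSpace 𝓘(ℝ, E) x →L[ℝ] TangentSpace 𝓘(ℝ, E) x →L[ℝ] ℝ

/-- A field of covectors (1-form, without any smoothness) on `M`. -/
abbrev CovectorField (E : Type*) [NormedAddCommGroup E] [NormedSpace ℝ E] (M : Type*)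
    [TopologicalSpace M] [ChartedSpace E M] : Type _ :=
  ∀ x : M, TangentSpace 𝓘(ℝ, E) x →L[ℝ] ℝ

section Connection

variable {E : Type*} [NormedAddCommGroup E] [NormedSpace ℝ E]
  {M : Type*} [TopologicalSpace M] [ChartedSpace E M]
  {F : Type*} [NormedAddCommGroup F] [NormedSpace ℝ F]
  {N : Type*} [TopologicalSpace N] [ChartedSpace F N]

/-- `V` is a smooth vector field along the smooth map `f : N → M`. -/
def IsSmoothAlong (F : Type*) [NormedAddCommGroup F] [NormedSpace ℝ F]
    {N : Type*} [TopologicalSpace N] [ChartedSpace F N] [IsManifold 𝓘(ℝ, E) ∞ M]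
    (f : N → M) (V : ∀ q : N, TangentSpace 𝓘(ℝ, E) (f q)) : Prop :=
  ContMDiff 𝓘(ℝ, F) 𝓘(ℝ, E).tangent ∞
    (fun q : N => (⟨f q, V q⟩ : TangentBundle 𝓘(ℝ, E) M))

/-- `V` is a smooth vector field on `M`. -/
def IsSmoothField [IsManifold 𝓘(ℝ, E) ∞ M] (V : ∀ x : M, TangentSpace 𝓘(ℝ, E) x) : Prop :=
  ContMDiff 𝓘(ℝ, E) 𝓘(ℝ, E).tangent ∞
    (fun x : M => (⟨x, V x⟩ : TangentBundle 𝓘(ℝ, E) M))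

/-- The expression of the bilinear field `g` in the preferred chart at `x`:
`y ↦ (a, b) ↦ g (∂_a, ∂_b)` at the point with coordinate `y`. -/
def metricInChart (g : BilinField E M) (x : M) (y : E) : E →L[ℝ] E →L[ℝ] ℝ :=
  let b : E →L[ℝ] E →L[ℝ] ℝ := g ((extChartAt 𝓘(ℝ, E) x).symm y)
  let d : E →L[ℝ] E := mfderiv 𝓘(ℝ, E) 𝓘(ℝ, E) (extChartAt 𝓘(ℝ, E) x).symm y
  b.bilinearComp d d

/-- The Christoffel symbols of `g` at `x`, in the preferred chart at `x`: the vector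
`Γ(a, b)` with `2 g(Γ(a, b), c) = D_a g(b, c) + D_b g(a, c) - D_c g(a, b)` for all `c`. -/
def christoffel (g : BilinField E M) (x : M) (a b : E) : E :=
  let y := extChartAt 𝓘(ℝ, E) x x
  let D : E →L[ℝ] E →L[ℝ] E →L[ℝ] ℝ := fderiv ℝ (metricInChart g x) y
  (metricInChart g x y).inverse ((1 / 2 : ℝ) • (D a b + D b a - (D.flip a).flip b))

/-- The Levi-Civita covariant derivative of the (Lorentzian or Riemannian) metric `g` on `M`,
applied to a vector field `V` along a map `f : N → M`, at `p` in the direction `w ∈ T_p N`.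
In the preferred chart of `M` at `f p` (which identifies `T_{f p} M` with `E`) it is
`w(V^k) + Γ^k_{ij} (df w)^i V^j`.  For `f` the identity this is the Levi-Civita connection of
`(M, g)`; for `f` an immersion it is the usual `∇_w V` with `V` extended locally to `M`. -/
def covAlong (g : BilinField E M) (f : N → M) (V : ∀ q : N, TangentSpace 𝓘(ℝ, E) (f q))
    (p : N) (w : TangentSpace 𝓘(ℝ, F) p) : TangentSpace 𝓘(ℝ, E) (f p) :=
  let coord : N → E := fun q =>
    mfderiv 𝓘(ℝ, E) 𝓘(ℝ, E) (extChartAt 𝓘(ℝ, E) (f p)) (f q) (V q)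
  let dcoord : E := mfderiv 𝓘(ℝ, F) 𝓘(ℝ, E) coord p w
  let corr : E := christoffel g (f p) (mfderiv 𝓘(ℝ, F) 𝓘(ℝ, E) f p w) (V p)
  dcoord + corr

/-- The expression of a 1-form in the preferred chart at `x`. -/
def covectorInChart (α : CovectorField E M) (x : M) (y : E) : E →L[ℝ] ℝ :=
  (α ((extChartAt 𝓘(ℝ, E) x).symm y)).comp
    (mfderiv 𝓘(ℝ, E) 𝓘(ℝ, E) (extChartAt 𝓘(ℝ, E) x).symm y)

/-- The exterior derivative `dα` at `x`, `dα(a, b) = D_a (α b) - D_b (α a)` for coordinate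
(constant) `a`, `b` in the preferred chart at `x`. -/
def extDerivOne (α : CovectorField E M) (x : M) (a b : TangentSpace 𝓘(ℝ, E) x) : ℝ :=
  let D : E →L[ℝ] E →L[ℝ] ℝ :=
    fderiv ℝ (covectorInChart α x) (extChartAt 𝓘(ℝ, E) x x)
  D a b - D b a

variable (E M) in
/-- A smooth Lorentzian metric on `M`, with signature `(-, +, …, +)`. -/
structure LorentzianMetric [IsManifold 𝓘(ℝ, E) ∞ M] where
  val : BilinField E M
  contMDiff : ContMDiff 𝓘(ℝ, E) (𝓘(ℝ, E).prod 𝓘(ℝ, E →L[ℝ] E →L[ℝ] ℝ)) ∞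
    (fun x : M => Bundle.TotalSpace.mk' (E →L[ℝ] E →L[ℝ] ℝ)
      (E := fun x : M => TangentSpace 𝓘(ℝ, E) x →L[ℝ] TangentSpace 𝓘(ℝ, E) x →L[ℝ] ℝ)
      x (val x))
  symm : ∀ (x : M) (a b : TangentSpace 𝓘(ℝ, E) x), val x a b = val x b a
  signature : ∀ x : M, ∃ t : TangentSpace 𝓘(ℝ, E) x, val x t t < 0 ∧
    ∀ a : TangentSpace 𝓘(ℝ, E) x, val x t a = 0 → a ≠ 0 → 0 < val x a a

end Connection

section Hypersurface

/-! ### Second fundamental form of an immersed submanifold of a Riemannian manifold -/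

variable {E : Type*} [NormedAddCommGroup E] [NormedSpace ℝ E]
  {L : Type*} [TopologicalSpace L] [ChartedSpace E L]
  {F : Type*} [NormedAddCommGroup F] [NormedSpace ℝ F]
  {S : Type*} [TopologicalSpace S] [ChartedSpace F S]
  [IsManifold 𝓘(ℝ, E) ∞ L] [IsManifold 𝓘(ℝ, F) ∞ S]

/-- The differential of `j`, applied to a vector field on `S`: a vector field along `j`. -/
def pushField (j : S → L) (V : ∀ s : S, TangentSpace 𝓘(ℝ, F) s) (s : S) :
    TangentSpace 𝓘(ℝ, E) (j s) :=
  mfderiv 𝓘(ℝ, F) 𝓘(ℝ, E) j s (V s)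

/-- The tangent space of the immersed submanifold `j : S → L`, as a subspace of `T_{j s} L`. -/
def tangentRange (j : S → L) (s : S) : Submodule ℝ (TangentSpace 𝓘(ℝ, E) (j s)) :=
  LinearMap.range (mfderiv 𝓘(ℝ, F) 𝓘(ℝ, E) j s).toLinearMap

/-- `z ∈ T_{j s} L` is normal to the immersed submanifold `j : S → L` for the metric `h`. -/
def IsNormalAt (h : BilinField E L) (j : S → L) (s : S)
    (z : TangentSpace 𝓘(ℝ, E) (j s)) : Prop :=
  ∀ a ∈ tangentRange (F := F) j s, h (j s) z a = 0

/-- Second fundamental form of `j : S → (L, h)`: the normal part of `∇_X Y`, that is,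
the normal vector `z` such that `∇_X Y - z` is tangent to `S`. -/
def secondFundForm (h : BilinField E L) (j : S → L) (X Y : ∀ s : S, TangentSpace 𝓘(ℝ, F) s)
    (s : S) : TangentSpace 𝓘(ℝ, E) (j s) :=
  Classical.epsilon fun z : TangentSpace 𝓘(ℝ, E) (j s) =>
    IsNormalAt (F := F) h j s z ∧
      covAlong h j (pushField j Y) s (X s) - z ∈ tangentRange (F := F) j s

/-- `S` is totally geodesic in `(L, h)`: its second fundamental form vanishes. -/
def IsTotallyGeodesic (F : Type*) [NormedAddCommGroup F] [NormedSpace ℝ F]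
    {S : Type*} [TopologicalSpace S] [ChartedSpace F S] [IsManifold 𝓘(ℝ, F) ∞ S]
    (h : BilinField E L) (j : S → L) : Prop :=
  ∀ X Y : (∀ s : S, TangentSpace 𝓘(ℝ, F) s), IsSmoothField X → IsSmoothField Y →
    ∀ s : S, secondFundForm h j X Y s = 0

/-- `S` is totally umbilic in `(L, h)`: `II(X, Y) = h(X, Y) Z` for a smooth normal field `Z`. -/
def IsTotallyUmbilic (F : Type*) [NormedAddCommGroup F] [NormedSpace ℝ F]
    {S : Type*} [TopologicalSpace S] [ChartedSpace F S] [IsManifold 𝓘(ℝ, F) ∞ S]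
    (h : BilinField E L) (j : S → L) : Prop :=
  ∃ Z : (∀ s : S, TangentSpace 𝓘(ℝ, E) (j s)), IsSmoothAlong F j Z ∧
    (∀ s, IsNormalAt (F := F) h j s (Z s)) ∧
    ∀ X Y : (∀ s : S, TangentSpace 𝓘(ℝ, F) s), IsSmoothField X → IsSmoothField Y →
      ∀ s : S, secondFundForm h j X Y s =
        h (j s) (pushField (E := E) j X s) (pushField (E := E) j Y s) • Z s

end Hypersurface

section Leaves

/-- A connected integral manifold of an `n`-dimensional distribution `D` on an
`(n + 1)`-dimensional manifold `L`: a connected `n`-dimensional manifold, injectively immersed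
in `L`, whose tangent space at every point is the fibre of `D`. -/
structure IntegralManifold {n : ℕ} {L : Type v} [TopologicalSpace L]
    [ChartedSpace (EuclideanSpace ℝ (Fin (n + 1))) L]
    (D : ∀ p : L, Submodule ℝ (TangentSpace (𝓡 (n + 1)) p)) where
  S : Type v
  [top : TopologicalSpace S]
  [charted : ChartedSpace (EuclideanSpace ℝ (Fin n)) S]
  [manifold : IsManifold (𝓡 n) ∞ S]
  [connected : ConnectedSpace S]
  incl : S → L
  injective : Function.Injective incl
  immersion : Manifold.IsImmersion (𝓡 n) (𝓡 (n + 1)) ∞ incl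
  tangent : ∀ s : S, tangentRange (F := EuclideanSpace ℝ (Fin n)) incl s = D (incl s)

attribute [instance] IntegralManifold.top IntegralManifold.charted IntegralManifold.manifold
  IntegralManifold.connected

/-- A leaf is a maximal connected integral manifold. -/
def IntegralManifold.IsLeaf {n : ℕ} {L : Type v} [TopologicalSpace L]
    [ChartedSpace (EuclideanSpace ℝ (Fin (n + 1))) L]
    {D : ∀ p : L, Submodule ℝ (TangentSpace (𝓡 (n + 1)) p)} (P : IntegralManifold D) : Prop :=
  ∀ Q : IntegralManifold D, (Set.range Q.incl ∩ Set.range P.incl).Nonempty →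
    Set.range Q.incl ⊆ Set.range P.incl

end Leaves

section Rigging

variable {n : ℕ} {M : Type u} [TopologicalSpace M]
  [ChartedSpace (EuclideanSpace ℝ (Fin (n + 2))) M] [IsManifold (𝓡 (n + 2)) ∞ M]
  {L : Type v} [TopologicalSpace L] [ChartedSpace (EuclideanSpace ℝ (Fin (n + 1))) L]
  [IsManifold (𝓡 (n + 1)) ∞ L]

/-- `i : L → M` is (the inclusion of) a lightlike hypersurface of the Lorentzian manifold
`(M, g)`: an injectively immersed hypersurface such that the metric induced on each of its
tangent spaces is degenerate. -/
structure IsLightlikeHypersurface (g : LorentzianMetric (EuclideanSpace ℝ (Fin (n + 2))) M)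
    (i : L → M) : Prop where
  injective : Function.Injective i
  immersion : Manifold.IsImmersion (𝓡 (n + 1)) (𝓡 (n + 2)) ∞ i
  degenerate : ∀ p : L, ∃ a : TangentSpace (𝓡 (n + 1)) p, a ≠ 0 ∧
    ∀ b : TangentSpace (𝓡 (n + 1)) p,
      g.val (i p) (mfderiv (𝓡 (n + 1)) (𝓡 (n + 2)) i p a)
        (mfderiv (𝓡 (n + 1)) (𝓡 (n + 2)) i p b) = 0

/-- A rigging for the hypersurface `i : L → M`: a smooth vector field defined on some open set
`dom` containing `L`, which is nowhere tangent to `L`.  (The values of `field` outside `dom`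
are irrelevant.) -/
structure Rigging (n : ℕ) {M : Type u} [TopologicalSpace M]
    [ChartedSpace (EuclideanSpace ℝ (Fin (n + 2))) M] [IsManifold (𝓡 (n + 2)) ∞ M]
    {L : Type v} [TopologicalSpace L] [ChartedSpace (EuclideanSpace ℝ (Fin (n + 1))) L]
    (i : L → M) where
  dom : Set M
  field : ∀ x : M, TangentSpace (𝓡 (n + 2)) x
  isOpen_dom : IsOpen dom
  range_subset : Set.range i ⊆ dom
  smoothOn : ContMDiffOn (𝓡 (n + 2)) (𝓡 (n + 2)).tangent ∞
    (fun x : M => (⟨x, field x⟩ : TangentBundle (𝓡 (n + 2)) M)) dom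
  not_tangent : ∀ p : L,
    field (i p) ∉ tangentRange (F := EuclideanSpace ℝ (Fin (n + 1))) i p

variable (g : LorentzianMetric (EuclideanSpace ℝ (Fin (n + 2))) M) {i : L → M} (ζ : Rigging n i)

namespace Rigging

/-- The 1-form `α = g(ζ, ·)` metrically equivalent to `ζ`. -/
def alpha : CovectorField (EuclideanSpace ℝ (Fin (n + 2))) M :=
  fun x => g.val x (ζ.field x)

/-- The rigging is closed: `dα = 0` on its domain. -/
def IsClosed : Prop :=
  ∀ x ∈ ζ.dom, ∀ a b : TangentSpace (𝓡 (n + 2)) x, extDerivOne (ζ.alpha g) x a b = 0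

/-- The 1-form `ω = i^* α` on `L`. -/
def omega : CovectorField (EuclideanSpace ℝ (Fin (n + 1))) L :=
  fun p => (ζ.alpha g (i p)).comp (mfderiv (𝓡 (n + 1)) (𝓡 (n + 2)) i p)

/-- The rigged metric `g̃ = i^* (g + α ⊗ α)` on `L`. -/
def riggedMetric : BilinField (EuclideanSpace ℝ (Fin (n + 1))) L :=
  fun p =>
    let b : EuclideanSpace ℝ (Fin (n + 2)) →L[ℝ] EuclideanSpace ℝ (Fin (n + 2)) →L[ℝ] ℝ :=
      g.val (i p)
    let a : EuclideanSpace ℝ (Fin (n + 2)) →L[ℝ] ℝ := ζ.alpha g (i p)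
    let d : EuclideanSpace ℝ (Fin (n + 1)) →L[ℝ] EuclideanSpace ℝ (Fin (n + 2)) :=
      mfderiv (𝓡 (n + 1)) (𝓡 (n + 2)) i p
    (b + a.smulRight a).bilinearComp d d

/-- The rigged vector field `ξ` on `L`, `g̃`-metrically equivalent to `ω`: `g̃(ξ, ·) = ω`. -/
def rigged : ∀ p : L, TangentSpace (𝓡 (n + 1)) p :=
  fun p => (ζ.riggedMetric g p).inverse (ζ.omega g p)

/-- The screen distribution `SL(ζ) = TL ∩ ζ^⊥`, as a distribution on `L`. -/
def screen : ∀ p : L, Submodule ℝ (TangentSpace (𝓡 (n + 1)) p) :=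
  fun p => LinearMap.ker (ζ.omega g p).toLinearMap

/-- The lightlike transverse vector field `N = ζ - (1/2) g(ζ, ζ) ξ` along `L`. -/
def transverse : ∀ p : L, TangentSpace (𝓡 (n + 2)) (i p) :=
  fun p => ζ.field (i p) -
    ((1 / 2 : ℝ) * g.val (i p) (ζ.field (i p)) (ζ.field (i p))) •
      (mfderiv (𝓡 (n + 1)) (𝓡 (n + 2)) i p (ζ.rigged g p))

/-- The second fundamental form `B` of `L`: the coefficient of `N` in the decomposition
`∇_U V = ∇^L_U V + B(U, V) N` with `∇^L_U V` tangent to `L`. -/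
def lightlikeB (U V : ∀ p : L, TangentSpace (𝓡 (n + 1)) p) (p : L) : ℝ :=
  Classical.epsilon fun b : ℝ =>
    covAlong g.val i (pushField i V) p (U p) - b • ζ.transverse g p ∈
      tangentRange (F := EuclideanSpace ℝ (Fin (n + 1))) i p

/-- `L` is totally geodesic: `B = 0`. -/
def TotallyGeodesic : Prop :=
  ∀ U V : (∀ p : L, TangentSpace (𝓡 (n + 1)) p), IsSmoothField U → IsSmoothField V →
    ∀ p : L, ζ.lightlikeB g U V p = 0

/-- `L` is totally umbilic: `B = ρ g` for some smooth function `ρ` on `L`. -/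
def TotallyUmbilic : Prop :=
  ∃ ρ : L → ℝ, ContMDiff (𝓡 (n + 1)) 𝓘(ℝ, ℝ) ∞ ρ ∧
    ∀ U V : (∀ p : L, TangentSpace (𝓡 (n + 1)) p), IsSmoothField U → IsSmoothField V →
      ∀ p : L, ζ.lightlikeB g U V p =
        ρ p * g.val (i p) (mfderiv (𝓡 (n + 1)) (𝓡 (n + 2)) i p (U p))
          (mfderiv (𝓡 (n + 1)) (𝓡 (n + 2)) i p (V p))

/-- The rigged vector field is `g̃`-parallel: `∇̃_w ξ = 0` for every tangent vector `w` of `L`,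
where `∇̃` is the Levi-Civita connection of `(L, g̃)`. -/
def RiggedIsParallel : Prop :=
  ∀ (p : L) (w : TangentSpace (𝓡 (n + 1)) p),
    covAlong (ζ.riggedMetric g) (fun q : L => q) (ζ.rigged g) p w = 0

end Rigging

end Rigging

end LightlikeRigging

end

noncomputable section

namespace LightlikeRigging

set_option linter.unusedSectionVars false

open Filter Set Topology

/-! ### Smoothness of operator-valued maps. -/

section FiniteDimensional

/-! Everything is carried by one tensor on `L`, namely T = -∇̃ω (`negCovDeriv`). Since dω = 0, T is
symmetric (`negCovDeriv_symm`); since ω has g̃-length one, T(·, ξ) = 0 (`negCovDeriv_rigged`). Hence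
T is determined by its restriction to the screen ker ω (`negCovDeriv_proj`).

All the geometric objects of the theorem are T in disguise. As ξ is dual to ω, g̃(∇̃_w ξ, v) = -T(w,
v) (`metric_covAlong_rigged`), so ξ is parallel exactly when T = 0. Along a leaf, ω(Y) = 0 gives
ω(∇̃_X Y) = T(X, Y), and ξ is the unit normal, so the second fundamental form is T(X, Y) ξ
(`secondFundForm_eq`). Finally ξ is orthogonal to TL and g(N, ξ) = 1, so B(U, V) = g(∇_U V, ξ);
comparing the Koszul formulas of g and of g̃ = i^*g + ω⊗ω, the contribution of ω⊗ω is exactly the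
derivative of ω subtracted in T, because ω is closed, and B = T (`negCovDeriv_eq`, `lightlikeB_eq`).
Conceptually both are minus half a Lie derivative along ξ, and ω⊗ω is invariant under ξ. The umbilic
condition B = ρ g becomes T = ρ (g̃ - ω⊗ω).

Two points are not tensor algebra. Knowing T on leaves only helps if a leaf passes through every
point: this is Frobenius for a closed form, where a local primitive of ω is completed to a chart,
its level sets form an atlas of a finer topology on `L`, and the components of that topology are the
leaves (`exists_foliatedChart`, `isLeaf_leafThrough`). And leafwise umbilicity yields ρ only
pointwise; its smoothness on `L` comes from writing ρ as a quotient whose numerator T(W, W) is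
smooth by the Lie derivative formula (`negCovDeriv_self_eq_lie`). For n = 0 the quotient is
unavailable, but T = 0 and ρ = 0 works. -/

/-- In a basis of the finite-dimensional `E`, an operator is the tuple of its values. Smoothness of
a metric in a chart thus reduces to that of its components. -/
theorem contDiffAt_clm_apply_iff {D E F : Type*} [NormedAddCommGroup D] [NormedSpace ℝ D]
    [NormedAddCommGroup E] [NormedSpace ℝ E] [NormedAddCommGroup F] [NormedSpace ℝ F]
    [FiniteDimensional ℝ E] {m : ℕ∞ω} {f : D → E →L[ℝ] F} {x : D} :
    ContDiffAt ℝ m f x ↔ ∀ y, ContDiffAt ℝ m (fun z => f z y) x := by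
  refine ⟨fun h y => h.clm_apply contDiffAt_const, fun h => ?_⟩
  let d := Module.finrank ℝ E
  have hd : d = Module.finrank ℝ (Fin d → ℝ) := (Module.finrank_fin_fun ℝ).symm
  let e₁ := ContinuousLinearEquiv.ofFinrankEq hd
  let e₂ := (e₁.arrowCongr (1 : F ≃L[ℝ] F)).trans (ContinuousLinearEquiv.piRing (Fin d))
  rw [← Function.id_comp f, ← e₂.symm_comp_self]
  exact e₂.symm.contDiff.contDiffAt.comp x (contDiffAt_pi.mpr fun i => h _)

end FiniteDimensional

/-! ### Charts, coordinate frames and fields along maps. -/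

section Charts

variable {E : Type*} [NormedAddCommGroup E] [NormedSpace ℝ E]
  {M : Type*} [TopologicalSpace M] [ChartedSpace E M] [IsManifold 𝓘(ℝ, E) ∞ M]
  {F : Type*} [NormedAddCommGroup F] [NormedSpace ℝ F]
  {N : Type*} [TopologicalSpace N] [ChartedSpace F N] [IsManifold 𝓘(ℝ, F) ∞ N]

theorem extChartAt_target_mem_nhds_self {x : M} {y : E}
    (hy : y ∈ (extChartAt 𝓘(ℝ, E) x).target) : (extChartAt 𝓘(ℝ, E) x).target ∈ 𝓝 y :=
  extChartAt_target_mem_nhds' hy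

instance isManifold_one : IsManifold 𝓘(ℝ, E) 1 M := IsManifold.of_le (n := ∞) (by norm_num)

theorem mfderiv_chart_comp_symm {x : M} {y : E} (hy : y ∈ (extChartAt 𝓘(ℝ, E) x).target) (a : E) :
    mfderiv 𝓘(ℝ, E) 𝓘(ℝ, E) (extChartAt 𝓘(ℝ, E) x) ((extChartAt 𝓘(ℝ, E) x).symm y)
      (mfderiv 𝓘(ℝ, E) 𝓘(ℝ, E) (extChartAt 𝓘(ℝ, E) x).symm y a) = a := by
  have h := mfderiv_extChartAt_comp_mfderivWithin_extChartAt_symm (I := 𝓘(ℝ, E)) hy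
  simp only [modelWithCornersSelf_coe, range_id, mfderivWithin_univ] at h
  exact DFunLike.congr_fun h a

theorem mfderiv_symm_comp_chart {x : M} {z : M} (hz : z ∈ (chartAt E x).source)
    (a : TangentSpace 𝓘(ℝ, E) z) :
    mfderiv 𝓘(ℝ, E) 𝓘(ℝ, E) (extChartAt 𝓘(ℝ, E) x).symm (extChartAt 𝓘(ℝ, E) x z)
      (mfderiv 𝓘(ℝ, E) 𝓘(ℝ, E) (extChartAt 𝓘(ℝ, E) x) z a) = a := by
  have h := mfderivWithin_extChartAt_symm_comp_mfderiv_extChartAt' (I := 𝓘(ℝ, E)) (x := x) (y := z)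
    (by simpa using hz)
  simp only [modelWithCornersSelf_coe, range_id, mfderivWithin_univ] at h
  exact DFunLike.congr_fun h a

theorem mfderiv_symm_self (x : M) (a : E) :
    mfderiv 𝓘(ℝ, E) 𝓘(ℝ, E) (extChartAt 𝓘(ℝ, E) x).symm (extChartAt 𝓘(ℝ, E) x x) a = a := by
  have h := mfderivWithin_range_extChartAt_symm (I := 𝓘(ℝ, E)) (x := x)
  simp only [modelWithCornersSelf_coe, range_id, mfderivWithin_univ] at h
  exact DFunLike.congr_fun h a

theorem mfderiv_chart_self (x : M) (a : TangentSpace 𝓘(ℝ, E) x) :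
    mfderiv 𝓘(ℝ, E) 𝓘(ℝ, E) (extChartAt 𝓘(ℝ, E) x) x a = a :=
  DFunLike.congr_fun (mfderiv_extChartAt_self (I := 𝓘(ℝ, E)) (x := x)) a

theorem contMDiffAt_chart_symm {x : M} {y : E} (hy : y ∈ (extChartAt 𝓘(ℝ, E) x).target) :
    ContMDiffAt 𝓘(ℝ, E) 𝓘(ℝ, E) ∞ (extChartAt 𝓘(ℝ, E) x).symm y :=
  (contMDiffOn_extChartAt_symm x).contMDiffAt (extChartAt_target_mem_nhds_self hy)

/-- A vector field along `f` is smooth when `f` and its components in a chart are. -/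
theorem contMDiffAt_along_iff {f : N → M} {V : ∀ q, TangentSpace 𝓘(ℝ, E) (f q)} {p : N} {x : M}
    (hf : ContinuousAt f p) (hx : f p ∈ (chartAt E x).source) :
    ContMDiffAt 𝓘(ℝ, F) 𝓘(ℝ, E).tangent ∞ (fun q => (⟨f q, V q⟩ : TangentBundle 𝓘(ℝ, E) M)) p ↔
      ContMDiffAt 𝓘(ℝ, F) 𝓘(ℝ, E) ∞ f p ∧ ContMDiffAt 𝓘(ℝ, F) 𝓘(ℝ, E) ∞
        (fun q => (mfderiv 𝓘(ℝ, E) 𝓘(ℝ, E) (extChartAt 𝓘(ℝ, E) x) (f q) (V q) : E)) p := by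
  let e := trivializationAt E (TangentSpace 𝓘(ℝ, E) : M → Type _) x
  have he : (⟨f p, V p⟩ : TangentBundle 𝓘(ℝ, E) M) ∈ e.source := by
    simpa [e, TangentBundle.trivializationAt_source] using hx
  refine (e.contMDiffAt_iff (IB := 𝓘(ℝ, E)) (n := ∞)
      (f := fun q => (⟨f q, V q⟩ : TangentBundle 𝓘(ℝ, E) M)) he).trans
    (and_congr Iff.rfl (Filter.EventuallyEq.contMDiffAt_iff ?_))
  filter_upwards [hf.preimage_mem_nhds ((chartAt E x).open_source.mem_nhds hx)] with q hq
  -- Over the chart domain, the trivialization of the tangent bundle is the differential of the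
  -- chart.
  rw [← TangentBundle.continuousLinearMapAt_trivializationAt (I := 𝓘(ℝ, E)) hq]
  exact (Bundle.Trivialization.continuousLinearMapAt_apply_of_mem ℝ e (b := f q)
    (by simpa [e] using hq) (V q)).symm

theorem contMDiffAt_frame {x : M} {y : E} (hy : y ∈ (extChartAt 𝓘(ℝ, E) x).target) (a : E) :
    ContMDiffAt 𝓘(ℝ, E) 𝓘(ℝ, E).tangent ∞ (fun z : E =>
      (⟨(extChartAt 𝓘(ℝ, E) x).symm z,
        mfderiv 𝓘(ℝ, E) 𝓘(ℝ, E) (extChartAt 𝓘(ℝ, E) x).symm z a⟩ : TangentBundle 𝓘(ℝ, E) M)) y := by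
  refine (contMDiffAt_along_iff (x := x) (contMDiffAt_chart_symm hy).continuousAt ?_).2
    ⟨contMDiffAt_chart_symm hy, ?_⟩
  · simpa using (extChartAt 𝓘(ℝ, E) x).map_target hy
  · refine (contMDiffAt_const (c := a)).congr_of_eventuallyEq ?_
    filter_upwards [extChartAt_target_mem_nhds_self hy] with z hz
    exact mfderiv_chart_comp_symm hz a

theorem contMDiff_pushField {f : N → M} (hf : ContMDiff 𝓘(ℝ, F) 𝓘(ℝ, E) ∞ f)
    {V : ∀ q : N, TangentSpace 𝓘(ℝ, F) q} (hV : IsSmoothField V) :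
    IsSmoothAlong F f (pushField (E := E) f V) :=
  (hf.contMDiff_tangentMap (m := ∞) (by norm_num)).comp hV

theorem contMDiffAt_push_frame {f : N → M} (hf : ContMDiff 𝓘(ℝ, F) 𝓘(ℝ, E) ∞ f) {p : N} {y : F}
    (hy : y ∈ (extChartAt 𝓘(ℝ, F) p).target) (a : F) :
    ContMDiffAt 𝓘(ℝ, F) 𝓘(ℝ, E).tangent ∞ (fun z : F =>
      (⟨f ((extChartAt 𝓘(ℝ, F) p).symm z),
        mfderiv 𝓘(ℝ, F) 𝓘(ℝ, E) f ((extChartAt 𝓘(ℝ, F) p).symm z)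
          (mfderiv 𝓘(ℝ, F) 𝓘(ℝ, F) (extChartAt 𝓘(ℝ, F) p).symm z a)⟩ :
            TangentBundle 𝓘(ℝ, E) M)) y :=
  ((hf.contMDiff_tangentMap (m := ∞) (by norm_num)) _).comp y (contMDiffAt_frame hy a)

/-- A tangent vector extends to a smooth vector field. -/
theorem exists_smoothField_eq [FiniteDimensional ℝ E] [T2Space M] (p : M)
    (v : TangentSpace 𝓘(ℝ, E) p) :
    ∃ V : ∀ x : M, TangentSpace 𝓘(ℝ, E) x, IsSmoothField V ∧ V p = v := by
  let f : SmoothBumpFunction 𝓘(ℝ, E) p := Classical.choice inferInstance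
  let w : E := v
  -- The field with constant components `w` in the chart at `p`; only its values on the chart domain
  -- matter, since it is cut off by the bump function.
  let W : ∀ x : M, TangentSpace 𝓘(ℝ, E) x := fun x =>
    mfderiv 𝓘(ℝ, E) 𝓘(ℝ, E) (extChartAt 𝓘(ℝ, E) p).symm (extChartAt 𝓘(ℝ, E) p x) w
  have hW : ContMDiffOn 𝓘(ℝ, E) 𝓘(ℝ, E).tangent ∞
      (fun x => (⟨x, W x⟩ : TangentBundle 𝓘(ℝ, E) M)) (chartAt E p).source := by
    intro x hx
    refine ContMDiffAt.contMDiffWithinAt ?_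
    refine (contMDiffAt_along_iff (f := fun x : M => x) (x := p) continuousAt_id hx).2
      ⟨contMDiffAt_id, (contMDiffAt_const (c := w)).congr_of_eventuallyEq ?_⟩
    filter_upwards [(chartAt E p).open_source.mem_nhds hx] with z hz
    have hz' : z ∈ (extChartAt 𝓘(ℝ, E) p).source := by simpa using hz
    have := mfderiv_chart_comp_symm ((extChartAt 𝓘(ℝ, E) p).map_source hz') w
    rwa [(extChartAt 𝓘(ℝ, E) p).left_inv hz'] at this
  refine ⟨(f : M → ℝ) • W, ContMDiffOn.smul_section_of_tsupport f.contMDiff.contMDiffOn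
    (chartAt E p).open_source f.tsupport_subset_chartAt_source hW, ?_⟩
  change f p • W p = v
  rw [f.eq_one]
  refine (one_smul ℝ _).trans ?_
  exact mfderiv_symm_self p w

/-- The expression of `f` in the preferred charts at `p` and at `x`. -/
def chartRep (f : N → M) (p : N) (x : M) : F → E :=
  extChartAt 𝓘(ℝ, E) x ∘ f ∘ (extChartAt 𝓘(ℝ, F) p).symm

theorem contDiffAt_chartRep {f : N → M} (hf : ContMDiff 𝓘(ℝ, F) 𝓘(ℝ, E) ∞ f) {p : N} {x : M}
    {y : F} (hy : y ∈ (extChartAt 𝓘(ℝ, F) p).target)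
    (hx : f ((extChartAt 𝓘(ℝ, F) p).symm y) ∈ (chartAt E x).source) :
    ContDiffAt ℝ ∞ (chartRep (E := E) f p x) y := by
  rw [← contMDiffAt_iff_contDiffAt]
  exact ContMDiffAt.comp y (contMDiffAt_extChartAt' (I := 𝓘(ℝ, E)) hx)
    (ContMDiffAt.comp y (hf _) (contMDiffAt_chart_symm hy))

theorem fderiv_chartRep {f : N → M} (hf : ContMDiff 𝓘(ℝ, F) 𝓘(ℝ, E) ∞ f) {p : N} {x : M}
    {y : F} (hy : y ∈ (extChartAt 𝓘(ℝ, F) p).target)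
    (hx : f ((extChartAt 𝓘(ℝ, F) p).symm y) ∈ (chartAt E x).source) (a : F) :
    fderiv ℝ (chartRep (E := E) f p x) y a =
      mfderiv 𝓘(ℝ, E) 𝓘(ℝ, E) (extChartAt 𝓘(ℝ, E) x) (f ((extChartAt 𝓘(ℝ, F) p).symm y))
        (mfderiv 𝓘(ℝ, F) 𝓘(ℝ, E) f ((extChartAt 𝓘(ℝ, F) p).symm y)
          (mfderiv 𝓘(ℝ, F) 𝓘(ℝ, F) (extChartAt 𝓘(ℝ, F) p).symm y a)) := by
  rw [← mfderiv_eq_fderiv]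
  have h1 := (contMDiffAt_chart_symm hy).mdifferentiableAt (by norm_num)
  have h2 := (hf ((extChartAt 𝓘(ℝ, F) p).symm y)).mdifferentiableAt (by norm_num)
  have h3 := (contMDiffAt_extChartAt' (I := 𝓘(ℝ, E)) (n := ∞) hx).mdifferentiableAt (by norm_num)
  have h := mfderiv_comp y (I' := 𝓘(ℝ, E)) h3 (h2.comp y h1)
  rw [mfderiv_comp y h2 h1] at h
  exact DFunLike.congr_fun h a

/-- `d ψ_x (D φ a) = df (d ψ_p a)`, for the inverse charts `ψ_x` and `ψ_p`. -/
theorem mfderiv_symm_fderiv_chartRep {f : N → M} (hf : ContMDiff 𝓘(ℝ, F) 𝓘(ℝ, E) ∞ f) {p : N}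
    {x : M} {y : F} (hy : y ∈ (extChartAt 𝓘(ℝ, F) p).target)
    (hx : f ((extChartAt 𝓘(ℝ, F) p).symm y) ∈ (chartAt E x).source) (a : F) :
    mfderiv 𝓘(ℝ, E) 𝓘(ℝ, E) (extChartAt 𝓘(ℝ, E) x).symm (chartRep (E := E) f p x y)
        (fderiv ℝ (chartRep (E := E) f p x) y a) =
      (mfderiv 𝓘(ℝ, F) 𝓘(ℝ, E) f ((extChartAt 𝓘(ℝ, F) p).symm y)
          (mfderiv 𝓘(ℝ, F) 𝓘(ℝ, F) (extChartAt 𝓘(ℝ, F) p).symm y a) : E) := by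
  rw [fderiv_chartRep hf hy hx]
  exact mfderiv_symm_comp_chart hx _

theorem symm_chartRep {f : N → M} {p : N}
    {x : M} {y : F} (hx : f ((extChartAt 𝓘(ℝ, F) p).symm y) ∈ (chartAt E x).source) :
    (extChartAt 𝓘(ℝ, E) x).symm (chartRep (E := E) f p x y) = f ((extChartAt 𝓘(ℝ, F) p).symm y) :=
  (extChartAt 𝓘(ℝ, E) x).left_inv (by simpa using hx)

end Charts

/-! ### Metrics, covectors and Christoffel symbols in coordinates. -/

section Christoffel

variable {E : Type*} [NormedAddCommGroup E] [NormedSpace ℝ E]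
  {M : Type*} [TopologicalSpace M] [ChartedSpace E M]

theorem isInvertible_of_nondegenerate [FiniteDimensional ℝ E] (b : E →L[ℝ] E →L[ℝ] ℝ)
    (hb : ∀ a, (∀ c, b a c = 0) → a = 0) : b.IsInvertible := by
  have hinj : Function.Injective (b : E →ₗ[ℝ] E →L[ℝ] ℝ) :=
    (injective_iff_map_eq_zero _).2 fun a ha => hb a fun c => DFunLike.congr_fun ha c
  have hdim : Module.finrank ℝ E = Module.finrank ℝ (E →L[ℝ] ℝ) :=
    (Subspace.dual_finrank_eq (K := ℝ) (V := E)).symm.trans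
      (LinearMap.toContinuousLinearMap (𝕜 := ℝ) (E := E) (F' := ℝ)).finrank_eq
  exact ⟨(LinearEquiv.ofInjectiveOfFinrankEq _ hinj hdim).toContinuousLinearEquiv, by ext; rfl⟩

/-- The value of a field of bilinear forms, on the model space. -/
def bilinAt (g : BilinField E M) (x : M) : E →L[ℝ] E →L[ℝ] ℝ := g x

/-- The value of a field of covectors, on the model space. -/
def covecAt (α : CovectorField E M) (x : M) : E →L[ℝ] ℝ := α x

/-- A tangent vector, as an element of the model space. -/
def vecAt (x : M) (a : TangentSpace 𝓘(ℝ, E) x) : E := a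

/-- The differential of the preferred chart at `x`, on the model space. -/
def dChart (E : Type*) [NormedAddCommGroup E] [NormedSpace ℝ E]
    {M : Type*} [TopologicalSpace M] [ChartedSpace E M] (x z : M) : E →L[ℝ] E :=
  mfderiv 𝓘(ℝ, E) 𝓘(ℝ, E) (extChartAt 𝓘(ℝ, E) x) z

/-- The differential of the inverse of the preferred chart at `x`, on the model space. -/
def dSymm (x : M) (y : E) : E →L[ℝ] E :=
  mfderiv 𝓘(ℝ, E) 𝓘(ℝ, E) (extChartAt 𝓘(ℝ, E) x).symm y

theorem metricInChart_apply (g : BilinField E M) (x : M) (y a b : E) :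
    metricInChart g x y a b =
      bilinAt g ((extChartAt 𝓘(ℝ, E) x).symm y) (dSymm x y a) (dSymm x y b) := rfl

theorem covectorInChart_apply (α : CovectorField E M) (x : M) (y a : E) :
    covectorInChart α x y a = covecAt α ((extChartAt 𝓘(ℝ, E) x).symm y) (dSymm x y a) := rfl

variable [IsManifold 𝓘(ℝ, E) ∞ M]

theorem dChart_self (x : M) (a : E) : dChart E x x a = a := mfderiv_chart_self x a

theorem dSymm_self (x : M) (a : E) : dSymm x (extChartAt 𝓘(ℝ, E) x x) a = a :=
  mfderiv_symm_self x a

theorem dSymm_dChart {x z : M} (hz : z ∈ (chartAt E x).source) (a : E) :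
    dSymm x (extChartAt 𝓘(ℝ, E) x z) (dChart E x z a) = a := mfderiv_symm_comp_chart hz a

theorem dChart_dSymm {x : M} {y : E} (hy : y ∈ (extChartAt 𝓘(ℝ, E) x).target) (a : E) :
    dChart E x ((extChartAt 𝓘(ℝ, E) x).symm y) (dSymm x y a) = a := mfderiv_chart_comp_symm hy a

theorem metricInChart_self (g : BilinField E M) (x : M) :
    metricInChart g x (extChartAt 𝓘(ℝ, E) x x) = bilinAt g x := by
  ext a b
  rw [metricInChart_apply, dSymm_self, dSymm_self, extChartAt_to_inv]

theorem covectorInChart_self (α : CovectorField E M) (x : M) :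
    covectorInChart α x (extChartAt 𝓘(ℝ, E) x x) = covecAt α x := by
  ext a
  rw [covectorInChart_apply, dSymm_self, extChartAt_to_inv]

theorem metricInChart_chart (g : BilinField E M) {x z : M} (hz : z ∈ (chartAt E x).source)
    (a b : E) : metricInChart g x (extChartAt 𝓘(ℝ, E) x z) (dChart E x z a) (dChart E x z b) =
      bilinAt g z a b := by
  rw [metricInChart_apply, dSymm_dChart hz, dSymm_dChart hz,
    (extChartAt 𝓘(ℝ, E) x).left_inv (by simpa using hz)]

theorem covectorInChart_chart (α : CovectorField E M) {x z : M} (hz : z ∈ (chartAt E x).source)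
    (a : E) : covectorInChart α x (extChartAt 𝓘(ℝ, E) x z) (dChart E x z a) = covecAt α z a := by
  rw [covectorInChart_apply, dSymm_dChart hz, (extChartAt 𝓘(ℝ, E) x).left_inv (by simpa using hz)]

/-- The Koszul formula for the Christoffel symbols. -/
theorem metric_christoffel [FiniteDimensional ℝ E] (g : BilinField E M) (x : M)
    (hg : ∀ a, (∀ c, bilinAt g x a c = 0) → a = 0) (a b c : E) :
    bilinAt g x (christoffel g x a b) c =
      (1 / 2) * (fderiv ℝ (metricInChart g x) (extChartAt 𝓘(ℝ, E) x x) a b c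
        + fderiv ℝ (metricInChart g x) (extChartAt 𝓘(ℝ, E) x x) b a c
        - fderiv ℝ (metricInChart g x) (extChartAt 𝓘(ℝ, E) x x) c a b) := by
  rw [← metricInChart_self] at hg ⊢
  -- `inverse` is zero on non-invertible operators; nondegeneracy makes it the true inverse.
  exact DFunLike.congr_fun ((isInvertible_of_nondegenerate _ hg).self_apply_inverse _) c

end Christoffel

/-! ### The tensor -∇η of a closed unit form. -/

section UnitForm

variable {E : Type*} [NormedAddCommGroup E] [NormedSpace ℝ E]
  {L : Type*} [TopologicalSpace L] [ChartedSpace E L]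

/-- A smooth Riemannian metric `h` with a smooth closed `1`-form `η` of length one, metrically
equivalent to the smooth vector field `ξ`. -/
structure IsUnitClosedForm [IsManifold 𝓘(ℝ, E) ∞ L] (h : BilinField E L) (η : CovectorField E L)
    (ξ : ∀ p : L, TangentSpace 𝓘(ℝ, E) p) : Prop where
  metric_contDiffAt : ∀ x, ∀ y ∈ (extChartAt 𝓘(ℝ, E) x).target,
    ContDiffAt ℝ ∞ (metricInChart h x) y
  symm : ∀ (p : L) (a b : E), bilinAt h p a b = bilinAt h p b a
  pos : ∀ (p : L) (a : E), a ≠ 0 → 0 < bilinAt h p a a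
  form_contDiffAt : ∀ x, ∀ y ∈ (extChartAt 𝓘(ℝ, E) x).target,
    ContDiffAt ℝ ∞ (covectorInChart η x) y
  closed : ∀ x, ∀ y ∈ (extChartAt 𝓘(ℝ, E) x).target, ∀ a b,
    fderiv ℝ (covectorInChart η x) y a b = fderiv ℝ (covectorInChart η x) y b a
  dual : ∀ (p : L) (a : E), bilinAt h p (vecAt p (ξ p)) a = covecAt η p a
  unit : ∀ p : L, covecAt η p (vecAt p (ξ p)) = 1
  smooth : IsSmoothField ξ

/-- The tensor `-∇η`, that is `(u, v) ↦ η (∇_u v) - u (η v)`. -/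
def negCovDeriv (h : BilinField E L) (η : CovectorField E L) (p : L) (u v : E) : ℝ :=
  covecAt η p (christoffel h p u v) -
    fderiv ℝ (covectorInChart η p) (extChartAt 𝓘(ℝ, E) p p) u v

variable [IsManifold 𝓘(ℝ, E) ∞ L] [FiniteDimensional ℝ E] {h : BilinField E L}
  {η : CovectorField E L} {ξ : ∀ p : L, TangentSpace 𝓘(ℝ, E) p}
  {F : Type*} [NormedAddCommGroup F] [NormedSpace ℝ F]
  {N : Type*} [TopologicalSpace N] [ChartedSpace F N] [IsManifold 𝓘(ℝ, F) ∞ N]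

/-- The components, in the preferred chart at `x`, of the vector field `V` along `f`. -/
def comps {f : N → L} (x : L) (V : ∀ q, TangentSpace 𝓘(ℝ, E) (f q)) (q : N) : E :=
  dChart E x (f q) (vecAt (f q) (V q))

theorem contMDiffAt_comps {f : N → L} {x : L} {V : ∀ q, TangentSpace 𝓘(ℝ, E) (f q)} {p : N}
    (hV : ContMDiffAt 𝓘(ℝ, F) 𝓘(ℝ, E).tangent ∞
      (fun q : N => (⟨f q, V q⟩ : TangentBundle 𝓘(ℝ, E) L)) p)
    (hf : ContinuousAt f p) (hx : f p ∈ (chartAt E x).source) :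
    ContMDiffAt 𝓘(ℝ, F) 𝓘(ℝ, E) ∞ (comps x V) p :=
  ((contMDiffAt_along_iff hf hx).1 hV).2

/-- The components of a field in a chart, as functions on the chart. -/
def compsInChart (x : L) (V : ∀ q : L, TangentSpace 𝓘(ℝ, E) q) (y : E) : E :=
  comps (f := fun q => q) x V ((extChartAt 𝓘(ℝ, E) x).symm y)

theorem contDiffAt_compsInChart {x : L} {V : ∀ q : L, TangentSpace 𝓘(ℝ, E) q}
    {y : E} (hy : y ∈ (extChartAt 𝓘(ℝ, E) x).target) (hV : ContMDiffAt 𝓘(ℝ, E) 𝓘(ℝ, E).tangent ∞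
      (fun q : L => (⟨q, V q⟩ : TangentBundle 𝓘(ℝ, E) L)) ((extChartAt 𝓘(ℝ, E) x).symm y)) :
    ContDiffAt ℝ ∞ (compsInChart x V) y := by
  rw [← contMDiffAt_iff_contDiffAt]
  exact ContMDiffAt.comp (I' := 𝓘(ℝ, E)) y (contMDiffAt_comps (f := fun q => q) hV continuousAt_id
    (by simpa using (extChartAt 𝓘(ℝ, E) x).map_target hy)) (contMDiffAt_chart_symm hy)

theorem compsInChart_self (x : L) (V : ∀ q : L, TangentSpace 𝓘(ℝ, E) q) :
    compsInChart x V (extChartAt 𝓘(ℝ, E) x x) = vecAt x (V x) := by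
  have : ∀ z : L, z = x → comps (f := fun q => q) x V z = vecAt x (V x) := by
    rintro z rfl; exact dChart_self _ _
  exact this _ (extChartAt_to_inv x)

/-- The differential of `f`, on the model spaces. -/
def dMap (f : N → L) (p : N) : F →L[ℝ] E := mfderiv 𝓘(ℝ, F) 𝓘(ℝ, E) f p

theorem covAlong_eq (h : BilinField E L) (f : N → L) (V : ∀ q : N, TangentSpace 𝓘(ℝ, E) (f q))
    (p : N) (w : F) : vecAt (f p) (covAlong h f V p w) =
      dMap (E := E) (comps (f p) V) p w + christoffel h (f p) (dMap f p w) (vecAt (f p) (V p)) := rfl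

theorem dMap_eq_fderiv {k : N → E} {p : N} (hk : MDifferentiableAt 𝓘(ℝ, F) 𝓘(ℝ, E) k p) :
    dMap (E := E) k p = fderiv ℝ (k ∘ (extChartAt 𝓘(ℝ, F) p).symm) (extChartAt 𝓘(ℝ, F) p p) := by
  simp only [dMap, mfderiv, writtenInExtChartAt, modelWithCornersSelf_coe, range_id,
    fderivWithin_univ, extChartAt_model_space_eq_id, PartialEquiv.refl_coe, Function.id_comp]
  exact if_pos hk

theorem fderiv_chartRep_self {f : N → L} (hf : ContMDiff 𝓘(ℝ, F) 𝓘(ℝ, E) ∞ f) (p : N) (w : F) :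
    fderiv ℝ (chartRep (E := E) f p (f p)) (extChartAt 𝓘(ℝ, F) p p) w = dMap (E := E) f p w := by
  have hsymm := extChartAt_to_inv (I := 𝓘(ℝ, F)) p
  refine (fderiv_chartRep hf (mem_extChartAt_target p) (by rw [hsymm]; simp) w).trans ?_
  change dChart E (f p) (f ((extChartAt 𝓘(ℝ, F) p).symm (extChartAt 𝓘(ℝ, F) p p)))
    (dMap f ((extChartAt 𝓘(ℝ, F) p).symm (extChartAt 𝓘(ℝ, F) p p)) (dSymm p _ w)) = _
  rw [dSymm_self, hsymm, dChart_self]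

/-- The Lie bracket, in a chart. -/
theorem mlieBracket_eq (U V : ∀ q : L, TangentSpace 𝓘(ℝ, E) q) (p : L) :
    vecAt p (VectorField.mlieBracket 𝓘(ℝ, E) U V p) =
      fderiv ℝ (compsInChart p V) (extChartAt 𝓘(ℝ, E) p p) (vecAt p (U p)) -
        fderiv ℝ (compsInChart p U) (extChartAt 𝓘(ℝ, E) p p) (vecAt p (V p)) := by
  -- Mathlib defines the bracket by pulling fields back through the inverse chart; the pulled-back
  -- fields are the component functions near the base point.
  have key : ∀ W : (∀ q : L, TangentSpace 𝓘(ℝ, E) q),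
      VectorField.mpullbackWithin 𝓘(ℝ, E) 𝓘(ℝ, E) (extChartAt 𝓘(ℝ, E) p).symm W
        (range 𝓘(ℝ, E)) =ᶠ[𝓝 (extChartAt 𝓘(ℝ, E) p p)] compsInChart p W := by
    intro W
    filter_upwards [extChartAt_target_mem_nhds (I := 𝓘(ℝ, E)) p] with y hy
    have hinv := isInvertible_mfderivWithin_extChartAt_symm (I := 𝓘(ℝ, E)) (x := p) hy
    rw [VectorField.mpullbackWithin_apply]
    refine hinv.inverse_apply_eq.2 ?_
    simp only [modelWithCornersSelf_coe, range_id, mfderivWithin_univ]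
    have hz : (extChartAt 𝓘(ℝ, E) p).symm y ∈ (chartAt E p).source := by
      simpa using (extChartAt 𝓘(ℝ, E) p).map_target hy
    have := dSymm_dChart hz (vecAt _ (W ((extChartAt 𝓘(ℝ, E) p).symm y)))
    rw [(extChartAt 𝓘(ℝ, E) p).right_inv hy] at this
    exact this.symm
  have h1 := Filter.EventuallyEq.lieBracket_vectorField_eq (𝕜 := ℝ) (key U) (key V)
  rw [← compsInChart_self p U, ← compsInChart_self p V]
  refine Eq.trans ?_ h1
  rw [VectorField.mlieBracket, VectorField.mlieBracketWithin_apply]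
  have hinv := isInvertible_mfderiv_extChartAt (I := 𝓘(ℝ, E)) (mem_extChartAt_source (I := 𝓘(ℝ, E)) p)
  refine hinv.inverse_apply_eq.2 (Eq.trans ?_ (mfderiv_chart_self p _).symm)
  rw [preimage_univ, univ_inter]
  simp only [modelWithCornersSelf_coe, range_id]
  exact congrFun (VectorField.lieBracketWithin_univ (𝕜 := ℝ) (E := E)) _

namespace IsUnitClosedForm

section Pointwise

variable (H : IsUnitClosedForm h η ξ)

include H

theorem nondegenerate (p : L) (a : E) (ha : ∀ c, bilinAt h p a c = 0) : a = 0 := by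
  by_contra h0
  exact (H.pos p a h0).ne' (ha a)

theorem differentiableAt_metric (p : L) :
    DifferentiableAt ℝ (metricInChart h p) (extChartAt 𝓘(ℝ, E) p p) :=
  (H.metric_contDiffAt p _ (mem_extChartAt_target p)).differentiableAt (by norm_num)

theorem differentiableAt_form (p : L) :
    DifferentiableAt ℝ (covectorInChart η p) (extChartAt 𝓘(ℝ, E) p p) :=
  (H.form_contDiffAt p _ (mem_extChartAt_target p)).differentiableAt (by norm_num)

theorem fderiv_metric_symm (p : L) (a b c : E) :
    fderiv ℝ (metricInChart h p) (extChartAt 𝓘(ℝ, E) p p) a b c =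
      fderiv ℝ (metricInChart h p) (extChartAt 𝓘(ℝ, E) p p) a c b := by
  have hd := (H.differentiableAt_metric p).hasFDerivAt
  have h1 := (hd.clm_apply (hasFDerivAt_const b _)).clm_apply (hasFDerivAt_const c _)
  have h2 := (hd.clm_apply (hasFDerivAt_const c _)).clm_apply (hasFDerivAt_const b _)
  have heq : (fun y => metricInChart h p y b c) = fun y => metricInChart h p y c b := by
    funext y
    simp only [metricInChart_apply, H.symm]
  rw [heq] at h1
  simpa using DFunLike.congr_fun (h1.unique h2) a

theorem differentiableAt_comps (p : L) :
    DifferentiableAt ℝ (compsInChart p ξ) (extChartAt 𝓘(ℝ, E) p p) :=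
  (contDiffAt_compsInChart (mem_extChartAt_target p) (H.smooth _)).differentiableAt (by norm_num)

/-- The derivative of `h (ξ, b) = η b`. -/
theorem fderiv_dual (p : L) (w b : E) :
    fderiv ℝ (metricInChart h p) (extChartAt 𝓘(ℝ, E) p p) w (vecAt p (ξ p)) b +
      bilinAt h p (fderiv ℝ (compsInChart p ξ) (extChartAt 𝓘(ℝ, E) p p) w) b =
    fderiv ℝ (covectorInChart η p) (extChartAt 𝓘(ℝ, E) p p) w b := by
  have h1 := ((H.differentiableAt_metric p).hasFDerivAt.clm_apply
    (H.differentiableAt_comps p).hasFDerivAt).clm_apply (hasFDerivAt_const b _)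
  have h2 := (H.differentiableAt_form p).hasFDerivAt.clm_apply (hasFDerivAt_const b _)
  have heq : (fun y => covectorInChart η p y b) =ᶠ[𝓝 (extChartAt 𝓘(ℝ, E) p p)]
      fun y => metricInChart h p y (compsInChart p ξ y) b := by
    filter_upwards [extChartAt_target_mem_nhds (I := 𝓘(ℝ, E)) p] with y hy
    have hz : (extChartAt 𝓘(ℝ, E) p).symm y ∈ (chartAt E p).source := by
      simpa using (extChartAt 𝓘(ℝ, E) p).map_target hy
    have := dSymm_dChart hz (vecAt _ (ξ ((extChartAt 𝓘(ℝ, E) p).symm y)))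
    rw [(extChartAt 𝓘(ℝ, E) p).right_inv hy] at this
    rw [metricInChart_apply, compsInChart, comps, this, H.dual, covectorInChart_apply]
  have := DFunLike.congr_fun ((h1.congr_of_eventuallyEq heq).unique h2) w
  simp only [compsInChart_self, metricInChart_self] at this
  simpa [add_comm] using this

/-- The derivative of `η ξ = 1`. -/
theorem fderiv_unit (p : L) (w : E) :
    fderiv ℝ (covectorInChart η p) (extChartAt 𝓘(ℝ, E) p p) w (vecAt p (ξ p)) +
      covecAt η p (fderiv ℝ (compsInChart p ξ) (extChartAt 𝓘(ℝ, E) p p) w) = 0 := by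
  have h1 := (H.differentiableAt_form p).hasFDerivAt.clm_apply
    (H.differentiableAt_comps p).hasFDerivAt
  have heq : (fun _ => (1 : ℝ)) =ᶠ[𝓝 (extChartAt 𝓘(ℝ, E) p p)]
      fun y => covectorInChart η p y (compsInChart p ξ y) := by
    filter_upwards [extChartAt_target_mem_nhds (I := 𝓘(ℝ, E)) p] with y hy
    have hz : (extChartAt 𝓘(ℝ, E) p).symm y ∈ (chartAt E p).source := by
      simpa using (extChartAt 𝓘(ℝ, E) p).map_target hy
    have := dSymm_dChart hz (vecAt _ (ξ ((extChartAt 𝓘(ℝ, E) p).symm y)))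
    rw [(extChartAt 𝓘(ℝ, E) p).right_inv hy] at this
    rw [covectorInChart_apply, compsInChart, comps, this, H.unit]
  have := DFunLike.congr_fun ((h1.congr_of_eventuallyEq heq).unique (hasFDerivAt_const _ _)) w
  simp only [compsInChart_self, covectorInChart_self] at this
  simpa [add_comm] using this

/-- As η = h(ξ, ·), this is the Koszul formula tested against ξ. -/
theorem form_christoffel (p : L) (u v : E) :
    covecAt η p (christoffel h p u v) = (1 / 2) *
      (fderiv ℝ (metricInChart h p) (extChartAt 𝓘(ℝ, E) p p) u v (vecAt p (ξ p))
        + fderiv ℝ (metricInChart h p) (extChartAt 𝓘(ℝ, E) p p) v u (vecAt p (ξ p))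
        - fderiv ℝ (metricInChart h p) (extChartAt 𝓘(ℝ, E) p p) (vecAt p (ξ p)) u v) := by
  rw [← H.dual, H.symm, metric_christoffel h p (H.nondegenerate p)]

/-- The Koszul expression is symmetric because the connection is torsion-free, and the derivative of
η is symmetric because η is closed. -/
theorem negCovDeriv_symm (p : L) (u v : E) :
    negCovDeriv h η p u v = negCovDeriv h η p v u := by
  unfold negCovDeriv
  rw [ H.form_christoffel, H.form_christoffel,
    H.closed p _ (mem_extChartAt_target p) u v, H.fderiv_metric_symm p (vecAt p (ξ p)) u v]
  ring

/-- Unit length: (∇_u η)(ξ) = h(∇_u ξ, ξ) is half the derivative of h(ξ, ξ) = 1. -/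
theorem negCovDeriv_rigged (p : L) (u : E) : negCovDeriv h η p u (vecAt p (ξ p)) = 0 := by
  rw [negCovDeriv, H.form_christoffel]
  have h1 := H.fderiv_dual p u (vecAt p (ξ p))
  have h2 := H.fderiv_unit p u
  rw [H.symm, H.dual] at h1
  linarith

/-- The value of `∇ξ` is metrically equivalent to `∇η`. -/
theorem metric_covAlong_rigged (p : L) (w v : E) :
    bilinAt h p (vecAt p (covAlong h (fun q : L => q) ξ p w)) v = - negCovDeriv h η p w v := by
  have hd : MDifferentiableAt 𝓘(ℝ, E) 𝓘(ℝ, E) (comps (f := fun q : L => q) p ξ) p :=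
    (contMDiffAt_comps (f := fun q => q) (H.smooth p) continuousAt_id (by simp)).mdifferentiableAt
      (by norm_num)
  have hid : dMap (fun q : L => q) p w = w := by
    change mfderiv 𝓘(ℝ, E) 𝓘(ℝ, E) (id : L → L) p w = w
    rw [mfderiv_id]; rfl
  rw [covAlong_eq (f := fun q : L => q), dMap_eq_fderiv hd, hid, map_add, add_apply,
    metric_christoffel h p (H.nondegenerate p), negCovDeriv, H.form_christoffel]
  have h1 := H.fderiv_dual p w v
  change _ + bilinAt h p (fderiv ℝ (comps p ξ ∘ (extChartAt 𝓘(ℝ, E) p).symm) _ w) v = _ at h1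
  have h2 := H.fderiv_metric_symm p w v (vecAt p (ξ p))
  have h3 := H.fderiv_metric_symm p v w (vecAt p (ξ p))
  linarith

/-- On fields in the kernel of `η`, `η (∇_w V)` is given by the tensor `-∇η`. -/
theorem form_covAlong {f : N → L} (hf : ContMDiff 𝓘(ℝ, F) 𝓘(ℝ, E) ∞ f)
    {V : ∀ q, TangentSpace 𝓘(ℝ, E) (f q)} (hV : IsSmoothAlong F f V)
    (hη : ∀ q, covecAt η (f q) (vecAt (f q) (V q)) = 0) (p : N) (w : F) :
    covecAt η (f p) (vecAt (f p) (covAlong h f V p w)) =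
      negCovDeriv h η (f p) (dMap f p w) (vecAt (f p) (V p)) := by
  have hc := contMDiffAt_comps (x := f p) (hV p) (hf p).continuousAt (by simp)
  have hd : MDifferentiableAt 𝓘(ℝ, F) 𝓘(ℝ, E) (comps (f p) V) p :=
    hc.mdifferentiableAt (by norm_num)
  have hsymm := extChartAt_to_inv (I := 𝓘(ℝ, F)) p
  have hd' : HasFDerivAt (comps (f p) V ∘ (extChartAt 𝓘(ℝ, F) p).symm)
      (dMap (E := E) (comps (f p) V) p) (extChartAt 𝓘(ℝ, F) p p) := by
    rw [dMap_eq_fderiv hd]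
    refine DifferentiableAt.hasFDerivAt (ContDiffAt.differentiableAt (n := ∞) ?_ (by norm_num))
    rw [← contMDiffAt_iff_contDiffAt]
    refine ContMDiffAt.comp (I' := 𝓘(ℝ, F)) _ ?_ (contMDiffAt_chart_symm (mem_extChartAt_target p))
    rwa [hsymm]
  have hsrc : f ((extChartAt 𝓘(ℝ, F) p).symm (extChartAt 𝓘(ℝ, F) p p)) ∈
      (chartAt E (f p)).source := by rw [hsymm]; simp
  have hr := ((contDiffAt_chartRep hf (mem_extChartAt_target p) hsrc).differentiableAt
    (by norm_num)).hasFDerivAt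
  have hval : chartRep (E := E) f p (f p) (extChartAt 𝓘(ℝ, F) p p) =
      extChartAt 𝓘(ℝ, E) (f p) (f p) := by
    simp only [chartRep, Function.comp_apply, hsymm]
  have hθ := (H.differentiableAt_form (f p)).hasFDerivAt
  rw [← hval] at hθ
  -- The identity η(V) = 0 is differentiated in charts: the derivative of the components of V is
  -- traded for the derivative of η along `f`.
  have h1 := (hθ.comp _ hr).clm_apply hd'
  have heq : (fun _ => (0 : ℝ)) =ᶠ[𝓝 (extChartAt 𝓘(ℝ, F) p p)] fun y =>
      (covectorInChart η (f p) ∘ chartRep f p (f p)) y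
        ((comps (f p) V ∘ (extChartAt 𝓘(ℝ, F) p).symm) y) := by
    have hcont : ContinuousAt (fun y => f ((extChartAt 𝓘(ℝ, F) p).symm y))
        (extChartAt 𝓘(ℝ, F) p p) :=
      (hf _).continuousAt.comp (contMDiffAt_chart_symm (mem_extChartAt_target p)).continuousAt
    filter_upwards [hcont.preimage_mem_nhds ((chartAt E (f p)).open_source.mem_nhds hsrc)] with y hy
    exact ((covectorInChart_chart η hy _).trans (hη _)).symm
  have := DFunLike.congr_fun ((h1.congr_of_eventuallyEq heq).unique (hasFDerivAt_const _ _)) w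
  have hself : comps (f p) V p = vecAt (f p) (V p) := dChart_self _ _
  simp only [Function.comp_apply, hsymm, hval, hself, covectorInChart_self,
    add_apply, ContinuousLinearMap.flip_apply, ContinuousLinearMap.comp_apply,
    zero_apply, fderiv_chartRep_self hf] at this
  rw [covAlong_eq, map_add]
  unfold negCovDeriv
  linarith

/-- The tensor `-∇η` is half the Lie derivative of `-h` along `ξ`. -/
theorem negCovDeriv_self_eq_lie {V : ∀ q : L, TangentSpace 𝓘(ℝ, E) q} (p : L)
    (hV : ContMDiffAt 𝓘(ℝ, E) 𝓘(ℝ, E).tangent ∞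
      (fun q : L => (⟨q, V q⟩ : TangentBundle 𝓘(ℝ, E) L)) p) :
    negCovDeriv h η p (vecAt p (V p)) (vecAt p (V p)) =
      - (1 / 2) * dMap (fun q => bilinAt h q (vecAt q (V q)) (vecAt q (V q))) p (vecAt p (ξ p)) +
        bilinAt h p (vecAt p (VectorField.mlieBracket 𝓘(ℝ, E) ξ V p)) (vecAt p (V p)) := by
  have hy0 := extChartAt_to_inv (I := 𝓘(ℝ, E)) p
  have hv : DifferentiableAt ℝ (compsInChart p V) (extChartAt 𝓘(ℝ, E) p p) :=
    (contDiffAt_compsInChart (mem_extChartAt_target p) (by rwa [hy0])).differentiableAt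
      (by norm_num)
  have h1 := ((H.differentiableAt_metric p).hasFDerivAt.clm_apply hv.hasFDerivAt).clm_apply
    hv.hasFDerivAt
  have heq : (fun q => bilinAt h q (vecAt q (V q)) (vecAt q (V q))) =ᶠ[𝓝 p]
      (fun y => metricInChart h p y (compsInChart p V y) (compsInChart p V y)) ∘
        extChartAt 𝓘(ℝ, E) p := by
    filter_upwards [(chartAt E p).open_source.mem_nhds (mem_chart_source E p)] with q hq
    rw [Function.comp_apply, compsInChart,
      (extChartAt 𝓘(ℝ, E) p).left_inv (by simpa using hq), comps, metricInChart_chart h hq]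
  have hm : HasMFDerivAt 𝓘(ℝ, E) 𝓘(ℝ, ℝ) (fun q => bilinAt h q (vecAt q (V q)) (vecAt q (V q))) p _ :=
    (HasMFDerivAt.comp (I' := 𝓘(ℝ, E)) p h1.hasMFDerivAt
      (hasMFDerivAt_extChartAt (I := 𝓘(ℝ, E)) (mem_chart_source E p))).congr_of_eventuallyEq heq
  -- The product rule for h(V, V) in coordinates; by symmetry of h the two terms differentiating V
  -- agree, whence the factor 2.
  have hd : dMap (E := ℝ) (fun q => bilinAt h q (vecAt q (V q)) (vecAt q (V q))) p (vecAt p (ξ p)) =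
      fderiv ℝ (metricInChart h p) (extChartAt 𝓘(ℝ, E) p p) (vecAt p (ξ p)) (vecAt p (V p))
        (vecAt p (V p)) + 2 * bilinAt h p
        (fderiv ℝ (compsInChart p V) (extChartAt 𝓘(ℝ, E) p p) (vecAt p (ξ p))) (vecAt p (V p)) := by
    refine (DFunLike.congr_fun hm.mfderiv (vecAt p (ξ p))).trans ?_
    refine Eq.trans (b := fderiv ℝ (fun y => metricInChart h p y (compsInChart p V y)
      (compsInChart p V y)) (extChartAt 𝓘(ℝ, E) p p) (dChart E p p (vecAt p (ξ p)))) ?_ ?_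
    · rw [h1.fderiv]; rfl
    · rw [h1.fderiv, dChart_self]
      simp only [compsInChart_self, metricInChart_self, add_apply, ContinuousLinearMap.flip_apply,
        ContinuousLinearMap.comp_apply]
      rw [H.symm p (vecAt p (V p))]
      ring
  rw [hd, mlieBracket_eq, map_sub, sub_apply, negCovDeriv, H.form_christoffel]
  have h2 := H.fderiv_dual p (vecAt p (V p)) (vecAt p (V p))
  have h3 := H.fderiv_metric_symm p (vecAt p (V p)) (vecAt p (V p)) (vecAt p (ξ p))
  linarith

end Pointwise

end IsUnitClosedForm

end UnitForm

/-! ### Functions with vanishing differential. -/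

section LocallyConstant

variable {F : Type*} [NormedAddCommGroup F] [NormedSpace ℝ F]
  {N : Type*} [TopologicalSpace N] [ChartedSpace F N] [IsManifold 𝓘(ℝ, F) ∞ N]

/-- A real function with vanishing differential is locally constant. -/
theorem eventually_eq_of_dMap_eq_zero {k : N → ℝ} {s : N}
    (hk : ∀ᶠ s' in 𝓝 s, MDifferentiableAt 𝓘(ℝ, F) 𝓘(ℝ, ℝ) k s')
    (hd : ∀ᶠ s' in 𝓝 s, ∀ w, dMap (F := F) (E := ℝ) k s' w = 0) : ∀ᶠ s' in 𝓝 s, k s' = k s := by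
  have hy0 := extChartAt_to_inv (I := 𝓘(ℝ, F)) s
  have hcont : Tendsto (extChartAt 𝓘(ℝ, F) s).symm (𝓝 (extChartAt 𝓘(ℝ, F) s s)) (𝓝 s) := by
    have := (contMDiffAt_chart_symm (mem_extChartAt_target (I := 𝓘(ℝ, F)) s)).continuousAt
    rwa [ContinuousAt, hy0] at this
  -- A coordinate ball is convex, so vanishing of the derivative there forces constancy.
  obtain ⟨r, hr, hball⟩ := Metric.mem_nhds_iff.1 (inter_mem (inter_mem (hcont.eventually hk)
    (hcont.eventually hd)) (extChartAt_target_mem_nhds (I := 𝓘(ℝ, F)) s))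
  have hder : ∀ y ∈ Metric.ball (extChartAt 𝓘(ℝ, F) s s) r,
      HasFDerivAt (k ∘ (extChartAt 𝓘(ℝ, F) s).symm) (0 : F →L[ℝ] ℝ) y := by
    intro y hy
    obtain ⟨⟨h1, h2⟩, h3⟩ := hball hy
    have h4 := (contMDiffAt_chart_symm h3).mdifferentiableAt (by norm_num)
    have h5 := (HasMFDerivAt.comp y h1.hasMFDerivAt h4.hasMFDerivAt).hasFDerivAt
    refine h5.congr_fderiv ?_
    ext w
    exact h2 (dSymm s y w)
  have hconst : ∀ y ∈ Metric.ball (extChartAt 𝓘(ℝ, F) s s) r,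
      (k ∘ (extChartAt 𝓘(ℝ, F) s).symm) y = k s := by
    intro y hy
    have := (convex_ball (extChartAt 𝓘(ℝ, F) s s) r).is_const_of_fderivWithin_eq_zero (𝕜 := ℝ)
      (f := k ∘ (extChartAt 𝓘(ℝ, F) s).symm)
      (fun z hz => (hder z hz).differentiableAt.differentiableWithinAt)
      (fun z hz => by
        rw [fderivWithin_of_isOpen Metric.isOpen_ball hz, (hder z hz).fderiv])
      hy (Metric.mem_ball_self hr)
    rw [this, Function.comp_apply, hy0]
  filter_upwards [(continuousAt_extChartAt (I := 𝓘(ℝ, F)) s).preimage_mem_nhds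
    (Metric.ball_mem_nhds _ hr), extChartAt_source_mem_nhds (I := 𝓘(ℝ, F)) s] with z hz hz'
  have := hconst _ hz
  rwa [Function.comp_apply, (extChartAt 𝓘(ℝ, F) s).left_inv hz'] at this

end LocallyConstant

/-! ### Charts with a primitive of η as a coordinate. -/

section FoliatedChart

variable {E : Type*} [NormedAddCommGroup E] [NormedSpace ℝ E] [FiniteDimensional ℝ E]
  {L : Type*} [TopologicalSpace L] [ChartedSpace E L] [IsManifold 𝓘(ℝ, E) ∞ L]
  {F : Type*} [NormedAddCommGroup F] [NormedSpace ℝ F] [FiniteDimensional ℝ F]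
  {h : BilinField E L} {η : CovectorField E L} {ξ : ∀ p : L, TangentSpace 𝓘(ℝ, E) p}

/-- A linear map that is an isomorphism from ker θ onto `F` completes θ to a system of linear
coordinates. It supplies the remaining coordinates of the foliated chart. -/
theorem exists_equiv_snd_eq (A : (F × ℝ) ≃L[ℝ] E) {θ : E →L[ℝ] ℝ} (hθ : θ ≠ 0) :
    ∃ (π : E →L[ℝ] F) (D : E ≃L[ℝ] E), ∀ v, D v = A (π v, θ v) := by
  have hdim : Module.finrank ℝ E = Module.finrank ℝ F + 1 := by
    rw [← A.toLinearEquiv.finrank_eq]; simp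
  have hker : Module.finrank ℝ (LinearMap.ker θ.toLinearMap) = Module.finrank ℝ F := by
    have h1 := LinearMap.finrank_range_add_finrank_ker θ.toLinearMap
    have h2 : LinearMap.range θ.toLinearMap = ⊤ := by
      refine LinearMap.range_eq_top.2 (LinearMap.surjective ?_)
      intro h0
      exact hθ (ContinuousLinearMap.ext fun v => DFunLike.congr_fun h0 v)
    rw [h2, finrank_top, Module.finrank_self] at h1
    omega
  let κ : LinearMap.ker θ.toLinearMap ≃ₗ[ℝ] F := LinearEquiv.ofFinrankEq _ _ hker
  obtain ⟨π, hπ⟩ := LinearMap.exists_extend κ.toLinearMap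
  let D : E →ₗ[ℝ] E := A.toLinearEquiv.toLinearMap ∘ₗ (π.prod θ.toLinearMap)
  have hinj : Function.Injective D := by
    refine (injective_iff_map_eq_zero _).2 fun v hv => ?_
    have h1 : (π v, θ v) = (0 : F × ℝ) := A.injective (hv.trans (map_zero A).symm)
    have h2 : θ v = 0 := (Prod.ext_iff.1 h1).2
    have h3 : κ ⟨v, h2⟩ = 0 := by
      have := DFunLike.congr_fun hπ ⟨v, h2⟩
      exact this.symm.trans (Prod.ext_iff.1 h1).1
    exact congrArg Subtype.val ((map_eq_zero_iff κ κ.injective).1 h3)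
  exact ⟨LinearMap.toContinuousLinearMap π,
    (LinearEquiv.ofInjectiveEndo D hinj).toContinuousLinearEquiv, fun v => rfl⟩

/-- Around every point, there is a chart one of whose coordinates is a primitive of `η`. -/
theorem IsUnitClosedForm.exists_foliatedChart (H : IsUnitClosedForm h η ξ)
    (A : (F × ℝ) ≃L[ℝ] E) (p : L) :
    ∃ Φ : OpenPartialHomeomorph L E, p ∈ Φ.source ∧ Φ ∈ IsManifold.maximalAtlas 𝓘(ℝ, E) ∞ L ∧
      ∀ x ∈ Φ.source, ∀ v : E, (A.symm (dMap Φ x v)).2 = covecAt η x v := by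
  obtain ⟨r, hr, hball⟩ := Metric.mem_nhds_iff.1 (extChartAt_target_mem_nhds (I := 𝓘(ℝ, E)) p)
  set y₀ := extChartAt 𝓘(ℝ, E) p p with hy₀
  set B := Metric.ball y₀ r with hB
  have hB₀ : y₀ ∈ B := Metric.mem_ball_self hr
  have hθ : ContDiffOn ℝ ∞ (covectorInChart η p) B := fun y hy =>
    (H.form_contDiffAt p y (hball hy)).contDiffWithinAt
  -- The Poincaré lemma on a ball: a closed form has a primitive.
  obtain ⟨f, hf⟩ := (convex_ball y₀ r).exists_forall_hasFDerivAt_of_fderiv_symmetric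
    Metric.isOpen_ball (hθ.differentiableOn (by norm_num)) fun y hy => H.closed p y (hball hy)
  have hfs : ContDiffOn ℝ ∞ f B := by
    refine (contDiffOn_infty_iff_fderiv_of_isOpen Metric.isOpen_ball).2
      ⟨fun y hy => (hf y hy).differentiableAt.differentiableWithinAt, hθ.congr fun y hy => ?_⟩
    exact (hf y hy).fderiv
  have hne : covectorInChart η p y₀ ≠ 0 := by
    intro h0
    have := H.unit p
    rw [← covectorInChart_self, ← hy₀, h0] at this
    simp at this
  obtain ⟨π, D, hD⟩ := exists_equiv_snd_eq A hne
  -- The new coordinates: the linear π together with the primitive `f`. The derivative at `y₀` is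
  -- the isomorphism `D`, so the inverse function theorem applies.
  let G : E → E := fun y => A (π y, f y)
  let G' : E → E →L[ℝ] E := fun y =>
    (A : (F × ℝ) →L[ℝ] E).comp (π.prod (covectorInChart η p y))
  have hG : ∀ y ∈ B, HasFDerivAt G (G' y) y := fun y hy =>
    (A : (F × ℝ) →L[ℝ] E).hasFDerivAt.comp y (π.hasFDerivAt.prodMk (hf y hy))
  have hGs : ContDiffOn ℝ ∞ G B :=
    A.contDiff.comp_contDiffOn (π.contDiff.contDiffOn.prodMk hfs)
  have hGat : ∀ y ∈ B, ContDiffAt ℝ ∞ G y := fun y hy =>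
    hGs.contDiffAt (Metric.isOpen_ball.mem_nhds hy)
  have hG'c : ContinuousOn G' B := by
    have : G' = fun y => (A : (F × ℝ) →L[ℝ] E).comp ((ContinuousLinearMap.inl ℝ F ℝ).comp π) +
        ((A : (F × ℝ) →L[ℝ] E).comp (ContinuousLinearMap.inr ℝ F ℝ)).comp
          (covectorInChart η p y) := by
      funext y; ext v; simp [G', ← map_add]
    rw [this]
    exact continuousOn_const.add (continuousOn_const.clm_comp hθ.continuousOn)
  have hG'0 : G' y₀ = (D : E →L[ℝ] E) := by ext v; exact (hD v).symm
  let e := (hGat y₀ hB₀).toOpenPartialHomeomorph G (hG'0 ▸ hG y₀ hB₀) (by norm_num)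
  -- Shrinking to the open set where the derivative is invertible makes the inverse smooth on the
  -- whole target, not just at the image of `y₀`.
  let U := B ∩ G' ⁻¹' range ((↑) : (E ≃L[ℝ] E) → E →L[ℝ] E)
  have hU : IsOpen U := hG'c.isOpen_inter_preimage Metric.isOpen_ball ContinuousLinearEquiv.isOpen
  let e' := e.restrOpen U hU
  have he' : ∀ y ∈ e'.source, y ∈ U := fun y hy => hy.2
  have he's : ContDiffOn ℝ ∞ e'.symm e'.target := by
    intro z hz
    have hz' := he' _ (e'.map_target hz)
    obtain ⟨T, hT⟩ := hz'.2
    refine ContDiffAt.contDiffWithinAt (e'.contDiffAt_symm (f₀' := T) hz ?_ (hGat _ hz'.1))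
    rw [hT]
    exact hG _ hz'.1
  let Φ := (chartAt E p).trans e'
  have hΦs : ∀ x ∈ Φ.source, x ∈ (chartAt E p).source ∧ extChartAt 𝓘(ℝ, E) p x ∈ e'.source := by
    intro x hx
    simpa [Φ] using hx
  refine ⟨Φ, ?_, ?_, ?_⟩
  · have : y₀ ∈ e'.source := ⟨(hGat y₀ hB₀).mem_toOpenPartialHomeomorph_source _ _,
      hB₀, D, hG'0.symm⟩
    simpa [Φ, hy₀] using this
  · refine OpenPartialHomeomorph.mem_maximalAtlas_of_contMDiffOn Φ (fun x hx => ?_) fun z hz => ?_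
    · obtain ⟨h1, h2⟩ := hΦs x hx
      exact (ContMDiffAt.comp (I' := 𝓘(ℝ, E)) x (hGat _ (he' _ h2).1).contMDiffAt
        (contMDiffAt_extChartAt' (I := 𝓘(ℝ, E)) h1)).contMDiffWithinAt
    · have h1 : z ∈ e'.target := by
        have := hz; rw [OpenPartialHomeomorph.trans_target] at this; exact this.1
      have h2 : e'.symm z ∈ (extChartAt 𝓘(ℝ, E) p).target := hball (he' _ (e'.map_target h1)).1
      exact (ContMDiffAt.comp (I' := 𝓘(ℝ, E)) z (contMDiffAt_chart_symm h2)
        (he's.contDiffAt (e'.open_target.mem_nhds h1)).contMDiffAt).contMDiffWithinAt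
  · intro x hx v
    obtain ⟨h1, h2⟩ := hΦs x hx
    have h3 : dMap Φ x v = G' (extChartAt 𝓘(ℝ, E) p x) (dChart E p x v) := by
      have h4 := HasMFDerivAt.comp (I' := 𝓘(ℝ, E)) x (hG _ (he' _ h2).1).hasMFDerivAt
        ((contMDiffAt_extChartAt' (I := 𝓘(ℝ, E)) (n := ∞) h1).mdifferentiableAt
          (by norm_num)).hasMFDerivAt
      exact DFunLike.congr_fun h4.mfderiv v
    rw [h3]
    refine Eq.trans ?_ (covectorInChart_chart η h1 v)
    change (A.symm (A _)).2 = _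
    rw [A.symm_apply_apply]
    rfl

end FoliatedChart

/-! ### Injectivity of the differential of an immersion. -/

section Immersion

variable {E : Type*} [NormedAddCommGroup E] [NormedSpace ℝ E]
  {M : Type*} [TopologicalSpace M] [ChartedSpace E M] [IsManifold 𝓘(ℝ, E) ∞ M]
  {F : Type*} [NormedAddCommGroup F] [NormedSpace ℝ F]
  {N : Type*} [TopologicalSpace N] [ChartedSpace F N] [IsManifold 𝓘(ℝ, F) ∞ N]

/-- In immersion charts `f` is z ↦ (z, 0), so the domain chart is a projection of the codomain chart
composed with `f`. Its differential is injective and factors through that of `f`. -/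
theorem dMap_injective_of_isImmersionAt {f : N → M} {x : N}
    (hf : Manifold.IsImmersionAt 𝓘(ℝ, F) 𝓘(ℝ, E) ∞ f x) :
    Function.Injective (dMap (F := F) (E := E) f x) := by
  have hx := hf.mem_domChart_source
  have hdom : hf.domChart.MDifferentiable 𝓘(ℝ, F) 𝓘(ℝ, F) :=
    ⟨(contMDiffOn_of_mem_maximalAtlas hf.domChart_mem_maximalAtlas).mdifferentiableOn
      (by norm_num),
    (contMDiffOn_symm_of_mem_maximalAtlas hf.domChart_mem_maximalAtlas).mdifferentiableOn
      (by norm_num)⟩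
  have hcod := (contMDiffAt_of_mem_maximalAtlas hf.codChart_mem_maximalAtlas
    hf.mem_codChart_source).mdifferentiableAt (by norm_num)
  have hff := hf.contMDiffAt.mdifferentiableAt (by norm_num)
  let T : E →L[ℝ] F := (ContinuousLinearMap.fst ℝ F hf.complement).comp
    (hf.equiv.symm : E →L[ℝ] F × hf.complement)
  have heq : hf.domChart =ᶠ[𝓝 x] fun z => T (hf.codChart (f z)) := by
    filter_upwards [hf.domChart.open_source.mem_nhds hx] with z hz
    have hz' : hf.domChart z ∈ (hf.domChart.extend 𝓘(ℝ, F)).target := by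
      simpa using hf.domChart.map_source hz
    have := hf.writtenInCharts hz'
    simp only [Function.comp_apply, OpenPartialHomeomorph.extend_coe, modelWithCornersSelf_coe,
      OpenPartialHomeomorph.extend_coe_symm, modelWithCornersSelf_coe_symm, id,
      hf.domChart.left_inv hz] at this
    rw [this]
    simp [T]
  have h1 := HasMFDerivAt.comp (I' := 𝓘(ℝ, E)) x (T.hasFDerivAt (x := hf.codChart (f x))).hasMFDerivAt
    (HasMFDerivAt.comp (I' := 𝓘(ℝ, E)) x hcod.hasMFDerivAt hff.hasMFDerivAt)
  have h2 := (h1.congr_of_eventuallyEq heq).mfderiv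
  refine (injective_iff_map_eq_zero _).2 fun v hv => ?_
  have h3 : mfderiv 𝓘(ℝ, F) 𝓘(ℝ, F) hf.domChart x v = 0 := by
    rw [h2]
    change T (dMap (F := E) (E := E) hf.codChart (f x) (dMap (F := F) (E := E) f x v)) = 0
    rw [hv, map_zero, map_zero]
  exact (map_eq_zero_iff _ (hdom.mfderiv_injective hx)).1 h3

end Immersion

/-! ### Frobenius for a closed form: plaques, the leaf topology and leaves. -/

namespace IsUnitClosedForm

universe v

variable {n : ℕ} {L : Type v} [TopologicalSpace L]
  [ChartedSpace (EuclideanSpace ℝ (Fin (n + 1))) L] [IsManifold (𝓡 (n + 1)) ∞ L]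
  {h : BilinField (EuclideanSpace ℝ (Fin (n + 1))) L}
  {η : CovectorField (EuclideanSpace ℝ (Fin (n + 1))) L}
  {ξ : ∀ p : L, TangentSpace (𝓡 (n + 1)) p}
  {F : Type*} [NormedAddCommGroup F] [NormedSpace ℝ F]
  {N : Type*} [TopologicalSpace N] [ChartedSpace F N] [IsManifold 𝓘(ℝ, F) ∞ N]

/-- A splitting of `ℝ ^ (n + 1)`. -/
def splitting (n : ℕ) :
    (EuclideanSpace ℝ (Fin n) × ℝ) ≃L[ℝ] EuclideanSpace ℝ (Fin (n + 1)) :=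
  ContinuousLinearEquiv.ofFinrankEq (by simp)

variable (H : IsUnitClosedForm h η ξ)

include H in
theorem exists_foliatedChart' (p : L) :
    ∃ Φ : OpenPartialHomeomorph L (EuclideanSpace ℝ (Fin (n + 1))), p ∈ Φ.source ∧
      Φ ∈ IsManifold.maximalAtlas (𝓡 (n + 1)) ∞ L ∧
      ∀ x ∈ Φ.source, ∀ v, ((splitting n).symm (dMap Φ x v)).2 = covecAt η x v :=
  H.exists_foliatedChart (splitting n) p

/-- A chart around `p`, whose last coordinate is a primitive of `η`. -/
def foliatedChart (p : L) : OpenPartialHomeomorph L (EuclideanSpace ℝ (Fin (n + 1))) :=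
  (H.exists_foliatedChart' p).choose

theorem mem_foliatedChart_source (p : L) : p ∈ (H.foliatedChart p).source :=
  (H.exists_foliatedChart' p).choose_spec.1

theorem foliatedChart_mem_maximalAtlas (p : L) :
    H.foliatedChart p ∈ IsManifold.maximalAtlas (𝓡 (n + 1)) ∞ L :=
  (H.exists_foliatedChart' p).choose_spec.2.1

/-- The last coordinate of the foliated chart at `p`. -/
def height (p x : L) : ℝ := ((splitting n).symm (H.foliatedChart p x)).2

theorem hasMFDerivAt_height {p x : L} (hx : x ∈ (H.foliatedChart p).source) :
    HasMFDerivAt (𝓡 (n + 1)) 𝓘(ℝ, ℝ) (H.height p) x (covecAt η x) := by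
  have h1 := (contMDiffAt_of_mem_maximalAtlas (H.foliatedChart_mem_maximalAtlas p)
    hx).mdifferentiableAt (by norm_num)
  let T : EuclideanSpace ℝ (Fin (n + 1)) →L[ℝ] ℝ :=
    (ContinuousLinearMap.snd ℝ _ ℝ).comp (splitting n).symm.toContinuousLinearMap
  have h2 := HasMFDerivAt.comp (I' := 𝓡 (n + 1)) x
    (T.hasFDerivAt (x := H.foliatedChart p x)).hasMFDerivAt h1.hasMFDerivAt
  have h3 : T.comp (dMap (H.foliatedChart p) x) = covecAt η x :=
    ContinuousLinearMap.ext fun v => (H.exists_foliatedChart' p).choose_spec.2.2 x hx v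
  rw [← h3]
  exact h2

/-- The chart of the plaque through `p`. -/
def plaqueChart (p : L) : PartialEquiv L (EuclideanSpace ℝ (Fin n)) where
  toFun x := ((splitting n).symm (H.foliatedChart p x)).1
  invFun z := (H.foliatedChart p).symm (splitting n (z, H.height p p))
  -- The plaque is a level set of the height, in general not open in `L`; hence only a
  -- `PartialEquiv`, from which a new topology is built.
  source := {x ∈ (H.foliatedChart p).source | H.height p x = H.height p p}
  target := {z | splitting n (z, H.height p p) ∈ (H.foliatedChart p).target}
  map_source' := by
    rintro x ⟨hx, hx'⟩
    have : splitting n (((splitting n).symm (H.foliatedChart p x)).1, H.height p p) =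
        H.foliatedChart p x := by
      rw [← hx']; exact (splitting n).apply_symm_apply _
    change splitting n _ ∈ (H.foliatedChart p).target
    rw [this]
    exact (H.foliatedChart p).map_source hx
  map_target' := by
    intro z hz
    refine ⟨(H.foliatedChart p).map_target hz, ?_⟩
    rw [height, (H.foliatedChart p).right_inv hz, (splitting n).symm_apply_apply]
  left_inv' := by
    rintro x ⟨hx, hx'⟩
    have : splitting n (((splitting n).symm (H.foliatedChart p x)).1, H.height p p) =
        H.foliatedChart p x := by
      rw [← hx']; exact (splitting n).apply_symm_apply _
    rw [this, (H.foliatedChart p).left_inv hx]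
  right_inv' := by
    intro z hz
    rw [(H.foliatedChart p).right_inv hz, (splitting n).symm_apply_apply]

theorem mem_plaqueChart_source (p : L) : p ∈ (H.plaqueChart p).source :=
  ⟨H.mem_foliatedChart_source p, rfl⟩

theorem isOpen_plaqueChart_target (p : L) : IsOpen (H.plaqueChart p).target :=
  (H.foliatedChart p).open_target.preimage
    ((splitting n).continuous.comp (continuous_id.prodMk continuous_const))

theorem contMDiffAt_plaqueChart_symm (p : L) {z : EuclideanSpace ℝ (Fin n)}
    (hz : z ∈ (H.plaqueChart p).target) :
    ContMDiffAt (𝓡 n) (𝓡 (n + 1)) ∞ (H.plaqueChart p).symm z := by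
  have h1 := contMDiffAt_symm_of_mem_maximalAtlas (H.foliatedChart_mem_maximalAtlas p) hz
  have h2 : ContDiff ℝ ∞ fun z => splitting n (z, H.height p p) :=
    (splitting n).contDiff.comp (contDiff_id.prodMk contDiff_const)
  exact ContMDiffAt.comp (I' := 𝓡 (n + 1)) (g := (H.foliatedChart p).symm)
    (f := fun z => splitting n (z, H.height p p)) z h1 h2.contMDiff.contMDiffAt

theorem contMDiffAt_plaqueChart (p : L) {x : L} (hx : x ∈ (H.foliatedChart p).source) :
    ContMDiffAt (𝓡 (n + 1)) (𝓡 n) ∞ (H.plaqueChart p) x := by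
  have h1 := contMDiffAt_of_mem_maximalAtlas (H.foliatedChart_mem_maximalAtlas p) hx
  have h2 : ContDiff ℝ ∞ fun y => ((splitting n).symm y).1 := contDiff_fst.comp
    (splitting n).symm.contDiff
  exact ContMDiffAt.comp (I' := 𝓡 (n + 1)) (g := fun y => ((splitting n).symm y).1)
    (f := H.foliatedChart p) x h2.contMDiff.contMDiffAt h1

/-- A map tangent to `ker η` stays locally in a plaque. -/
theorem eventually_mem_plaque (p : L) {j : N → L} {s : N}
    (hj : ∀ᶠ s' in 𝓝 s, ContMDiffAt 𝓘(ℝ, F) (𝓡 (n + 1)) ∞ j s')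
    (hη : ∀ᶠ s' in 𝓝 s, ∀ w : F, covecAt η (j s') (dMap j s' w) = 0)
    (hs : j s ∈ (H.plaqueChart p).source) : ∀ᶠ s' in 𝓝 s, j s' ∈ (H.plaqueChart p).source := by
  have hsrc : ∀ᶠ s' in 𝓝 s, j s' ∈ (H.foliatedChart p).source :=
    hj.self_of_nhds.continuousAt.preimage_mem_nhds ((H.foliatedChart p).open_source.mem_nhds hs.1)
  have hd : ∀ᶠ s' in 𝓝 s, HasMFDerivAt 𝓘(ℝ, F) 𝓘(ℝ, ℝ) (H.height p ∘ j) s' (0 : F →L[ℝ] ℝ) := by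
    filter_upwards [hj, hη, hsrc] with s' h1 h2 h3
    have := HasMFDerivAt.comp s' (H.hasMFDerivAt_height h3)
      (h1.mdifferentiableAt (by norm_num)).hasMFDerivAt
    have h0 : (covecAt η (j s')).comp (dMap j s') = (0 : F →L[ℝ] ℝ) := ContinuousLinearMap.ext h2
    rw [← h0]
    exact this
  -- The differential of the height is η, which kills the tangent directions of `j`, so the height
  -- is locally constant along `j`.
  have hc := eventually_eq_of_dMap_eq_zero (k := H.height p ∘ j)
    (hd.mono fun _ h => h.mdifferentiableAt)
    (hd.mono fun _ h w => DFunLike.congr_fun h.mfderiv w)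
  filter_upwards [hsrc, hc] with s' h1 h2
  exact ⟨h1, h2.trans hs.2⟩

theorem form_dMap_plaqueChart_symm (p : L) {z : EuclideanSpace ℝ (Fin n)}
    (hz : z ∈ (H.plaqueChart p).target) (w : EuclideanSpace ℝ (Fin n)) :
    covecAt η ((H.plaqueChart p).symm z) (dMap (H.plaqueChart p).symm z w) = 0 := by
  have h1 := HasMFDerivAt.comp z (H.hasMFDerivAt_height ((H.plaqueChart p).map_target hz).1)
    ((H.contMDiffAt_plaqueChart_symm p hz).mdifferentiableAt (by norm_num)).hasMFDerivAt
  have heq : (H.height p ∘ (H.plaqueChart p).symm) =ᶠ[𝓝 z] fun _ => H.height p p := by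
    filter_upwards [(H.isOpen_plaqueChart_target p).mem_nhds hz] with z' hz'
    exact ((H.plaqueChart p).map_target hz').2
  have h2 := (h1.congr_of_eventuallyEq heq.symm).mfderiv
  rw [mfderiv_const] at h2
  exact (DFunLike.congr_fun h2 w).symm

/-- The inverse chart of one plaque is tangent to ker η, so wherever it meets another plaque it
stays there locally. This compatibility lets the plaques define an n-dimensional atlas. -/
theorem isOpen_plaque_transition_source (p q : L) :
    IsOpen ((H.plaqueChart p).symm.trans (H.plaqueChart q)).source := by
  refine isOpen_iff_mem_nhds.2 fun z hz => ?_
  rw [PartialEquiv.trans_source] at hz ⊢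
  have ht := (H.isOpen_plaqueChart_target p).mem_nhds hz.1
  refine inter_mem ht (H.eventually_mem_plaque (F := EuclideanSpace ℝ (Fin n))
    q (j := (H.plaqueChart p).symm) ?_ ?_ hz.2)
  · exact eventually_of_mem ht fun z' hz' => H.contMDiffAt_plaqueChart_symm p hz'
  · exact eventually_of_mem ht fun z' hz' => H.form_dMap_plaqueChart_symm p hz'

theorem contDiffOn_plaque_transition (p q : L) :
    ContDiffOn ℝ ∞ ((H.plaqueChart p).symm.trans (H.plaqueChart q))
      ((H.plaqueChart p).symm.trans (H.plaqueChart q)).source := by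
  intro z hz
  rw [PartialEquiv.trans_source] at hz
  refine ContDiffAt.contDiffWithinAt ?_
  rw [← contMDiffAt_iff_contDiffAt]
  exact ContMDiffAt.comp (I' := 𝓡 (n + 1)) (g := H.plaqueChart q) (f := (H.plaqueChart p).symm) z
    (H.contMDiffAt_plaqueChart q hz.2.1)
    (H.contMDiffAt_plaqueChart_symm p hz.1)

/-- The atlas of plaques. -/
def plaqueAtlas : ChartedSpaceCore (EuclideanSpace ℝ (Fin n)) L where
  atlas := range H.plaqueChart
  chartAt := H.plaqueChart
  mem_chart_source := H.mem_plaqueChart_source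
  chart_mem_atlas := mem_range_self
  open_source := by
    rintro _ _ ⟨p, rfl⟩ ⟨q, rfl⟩
    exact H.isOpen_plaque_transition_source p q
  continuousOn_toFun := by
    rintro _ _ ⟨p, rfl⟩ ⟨q, rfl⟩
    exact (H.contDiffOn_plaque_transition p q).continuousOn

/-- The manifold `L`, with the topology of the leaves of `ker η`. -/
def LeafSpace (_ : IsUnitClosedForm h η ξ) : Type v := L

instance : TopologicalSpace (LeafSpace H) := H.plaqueAtlas.toTopologicalSpace

instance : ChartedSpace (EuclideanSpace ℝ (Fin n)) (LeafSpace H) := H.plaqueAtlas.toChartedSpace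

/-- The identity, from the leaf topology to the manifold topology. -/
def LeafSpace.toManifold (x : LeafSpace H) : L := x

instance : IsManifold (𝓡 n) ∞ (LeafSpace H) := by
  refine isManifold_of_contDiffOn _ _ _ fun e e' he he' => ?_
  obtain ⟨_, ⟨p, rfl⟩, rfl⟩ := mem_iUnion₂.1 he
  obtain ⟨_, ⟨q, rfl⟩, rfl⟩ := mem_iUnion₂.1 he'
  refine (H.contDiffOn_plaque_transition p q).mono ?_
  simp only [modelWithCornersSelf_coe, range_id, inter_univ, modelWithCornersSelf_coe_symm,
    preimage_id]
  exact subset_rfl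

/-- The leaf topology is finer: near a point the identity is a plaque chart followed by its inverse,
which is smooth into `L`. -/
theorem LeafSpace.continuous_toManifold : Continuous (toManifold H) := by
  refine continuous_iff_continuousAt.2 fun x => ?_
  have h1 := (H.contMDiffAt_plaqueChart_symm (toManifold H x) ((H.plaqueChart _).map_source
    (H.mem_plaqueChart_source (toManifold H x)))).continuousAt
  have h2 := (chartAt (EuclideanSpace ℝ (Fin n)) x).continuousAt
    (mem_chart_source (EuclideanSpace ℝ (Fin n)) x)
  refine (ContinuousAt.comp (f := chartAt (EuclideanSpace ℝ (Fin n)) x)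
    (g := (H.plaqueChart (toManifold H x)).symm) h1 h2).congr ?_
  filter_upwards [(chartAt (EuclideanSpace ℝ (Fin n)) x).open_source.mem_nhds
    (mem_chart_source (EuclideanSpace ℝ (Fin n)) x)] with y hy
  exact (H.plaqueChart _).left_inv hy

/-- A map tangent to `ker η` is continuous for the leaf topology. -/
theorem continuous_leafSpace {j : N → LeafSpace H}
    (hj : ContMDiff 𝓘(ℝ, F) (𝓡 (n + 1)) ∞ (LeafSpace.toManifold H ∘ j))
    (hη : ∀ s, ∀ w : F, covecAt η (LeafSpace.toManifold H (j s))
      (dMap (LeafSpace.toManifold H ∘ j) s w) = 0) : Continuous j := by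
  refine continuous_iff_continuousAt.2 fun s => ?_
  have h1 := H.eventually_mem_plaque (F := F) (LeafSpace.toManifold H (j s))
    (Eventually.of_forall (f := 𝓝 s) hj) (Eventually.of_forall hη) (H.mem_plaqueChart_source _)
  -- Since `j` stays in one plaque near `s`, continuity can be tested in the plaque chart, which is
  -- the restriction of a map smooth on an open set of `L`.
  refine ((chartAt (EuclideanSpace ℝ (Fin n)) (j s)).continuousAt_iff_continuousAt_comp_left
    h1).2 ?_
  exact ContinuousAt.comp (g := H.plaqueChart (LeafSpace.toManifold H (j s)))
    (f := LeafSpace.toManifold H ∘ j)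
    (H.contMDiffAt_plaqueChart _ (H.mem_foliatedChart_source _)).continuousAt (hj s).continuousAt

/-- Between a plaque chart and the foliated chart the inclusion is z ↦ (z, constant). An open subset
is allowed because leaves will be open in the leaf topology. -/
theorem isImmersionAt_toManifold (S : TopologicalSpace.Opens (LeafSpace H)) (s : S) :
    Manifold.IsImmersionAtOfComplement ℝ (𝓡 n) (𝓡 (n + 1)) ∞
      (fun s : S => LeafSpace.toManifold H s.1) s := by
  set p := LeafSpace.toManifold H s.1
  -- Translating by `c` moves the plaque to last coordinate 0, as the normal form z ↦ (z, 0)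
  -- demands.
  let c := splitting n (0, H.height p p)
  let Ψ := (H.foliatedChart p).trans (Homeomorph.addRight (-c)).toOpenPartialHomeomorph
  have hΨ : Ψ ∈ IsManifold.maximalAtlas (𝓡 (n + 1)) ∞ L := by
    refine Ψ.mem_maximalAtlas_of_contMDiffOn (fun x hx => ?_) fun z hz => ?_
    · have hx' : x ∈ (H.foliatedChart p).source := by simpa [Ψ] using hx
      have h2 : ContDiff ℝ ∞ fun y : EuclideanSpace ℝ (Fin (n + 1)) => y + -c := by fun_prop
      exact (ContMDiffAt.comp (I' := 𝓡 (n + 1)) (g := fun y => y + -c) (f := H.foliatedChart p) x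
        h2.contMDiff.contMDiffAt (contMDiffAt_of_mem_maximalAtlas
          (H.foliatedChart_mem_maximalAtlas p) hx')).contMDiffWithinAt
    · have hz' : z + - -c ∈ (H.foliatedChart p).target := by
        rw [OpenPartialHomeomorph.trans_target] at hz
        exact hz.2
      have h2 : ContDiff ℝ ∞ fun y : EuclideanSpace ℝ (Fin (n + 1)) => y + - -c := by fun_prop
      exact (ContMDiffAt.comp (I' := 𝓡 (n + 1)) (g := (H.foliatedChart p).symm)
        (f := fun y => y + - -c) z (contMDiffAt_symm_of_mem_maximalAtlas
          (H.foliatedChart_mem_maximalAtlas p) hz')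
        h2.contMDiff.contMDiffAt).contMDiffWithinAt
  refine Manifold.IsImmersionAtOfComplement.mk_of_continuousAt
    ((LeafSpace.continuous_toManifold H).comp continuous_subtype_val).continuousAt
    (splitting n) (chartAt _ s) Ψ (mem_chart_source _ s) ?_
    (IsManifold.chart_mem_maximalAtlas s) hΨ ?_
  · simpa [Ψ] using H.mem_foliatedChart_source p
  · intro z hz
    have hz1 : z ∈ ((chartAt (EuclideanSpace ℝ (Fin n)) s.1).subtypeRestr ⟨s⟩).target := by
      simpa [TopologicalSpace.Opens.chartAt_eq] using hz
    have hz2 : z ∈ (H.plaqueChart p).target :=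
      (chartAt (EuclideanSpace ℝ (Fin n)) s.1).subtypeRestr_target_subset ⟨s⟩ hz1
    have hz3 := (chartAt (EuclideanSpace ℝ (Fin n)) s.1).subtypeRestr_symm_apply ⟨s⟩ hz1
    have hz4 : LeafSpace.toManifold H ((chartAt (EuclideanSpace ℝ (Fin n)) s).symm z).1 =
        (H.foliatedChart p).symm (splitting n (z, H.height p p)) :=
      congrArg (LeafSpace.toManifold H) hz3
    change H.foliatedChart p (LeafSpace.toManifold H
      ((chartAt (EuclideanSpace ℝ (Fin n)) s).symm z).1) + -c = splitting n (z, 0)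
    rw [hz4, (H.foliatedChart p).right_inv hz2, ← sub_eq_add_neg, ← map_sub]
    simp

include H in
theorem finrank_ker_form (p : L) :
    Module.finrank ℝ (LinearMap.ker (covecAt η p).toLinearMap) = n := by
  have h1 := LinearMap.finrank_range_add_finrank_ker (covecAt η p).toLinearMap
  have h2 : LinearMap.range (covecAt η p).toLinearMap = ⊤ := by
    refine LinearMap.range_eq_top.2 (LinearMap.surjective fun h0 => ?_)
    have h3 : covecAt η p (vecAt p (ξ p)) = 0 := DFunLike.congr_fun h0 _
    rw [H.unit] at h3
    exact one_ne_zero h3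
  rw [h2, finrank_top, Module.finrank_self, finrank_euclideanSpace_fin] at h1
  omega

/-- The connected component of `p` for the leaf topology, as an integral manifold of `ker η`. -/
def leafThrough (p : L) : IntegralManifold (L := L) fun p => LinearMap.ker (η p).toLinearMap :=
  -- Local connectedness makes the component open, so that it inherits the manifold structure.
  haveI : LocallyConnectedSpace (LeafSpace H) :=
    ChartedSpace.locallyConnectedSpace (EuclideanSpace ℝ (Fin n)) _
  let S : TopologicalSpace.Opens (LeafSpace H) :=
    ⟨connectedComponent (α := LeafSpace H) p, isOpen_connectedComponent⟩
  have him : Manifold.IsImmersionOfComplement ℝ (𝓡 n) (𝓡 (n + 1)) ∞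
      (fun s : S => LeafSpace.toManifold H s.1) := fun s => H.isImmersionAt_toManifold S s
  { S := S
    connected := Subtype.connectedSpace isConnected_connectedComponent
    incl := fun s => LeafSpace.toManifold H s.1
    injective := fun _ _ hs => Subtype.ext hs
    immersion := him.isImmersion
    tangent := by
      intro s
      set q := LeafSpace.toManifold H s.1
      have hker : ∀ w : EuclideanSpace ℝ (Fin n),
          covecAt η q (dMap (F := EuclideanSpace ℝ (Fin n))
            (fun s : S => LeafSpace.toManifold H s.1) s w) = 0 := by
        intro w
        have h1 := HasMFDerivAt.comp s (H.hasMFDerivAt_height (H.mem_foliatedChart_source q))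
          ((him.contMDiff s).mdifferentiableAt (by norm_num)).hasMFDerivAt
        -- The height is constant on the plaque around `s`, so its differential η vanishes on
        -- tangent vectors of the leaf.
        have heq : (fun _ => H.height q q) =ᶠ[𝓝 s]
            (H.height q ∘ fun s : S => LeafSpace.toManifold H s.1) := by
          filter_upwards [continuous_subtype_val.continuousAt.preimage_mem_nhds
            ((chartAt (EuclideanSpace ℝ (Fin n)) s.1).open_source.mem_nhds
              (mem_chart_source _ s.1))] with s' hs'
          exact hs'.2.symm
        have h2 := (h1.congr_of_eventuallyEq heq).mfderiv
        rw [mfderiv_const] at h2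
        exact (DFunLike.congr_fun h2 w).symm
      have hinj := dMap_injective_of_isImmersionAt (H.isImmersionAt_toManifold S s).isImmersionAt
      have hle : LinearMap.range (dMap (F := EuclideanSpace ℝ (Fin n))
          (E := EuclideanSpace ℝ (Fin (n + 1))) (fun s : S => LeafSpace.toManifold H s.1) s).toLinearMap ≤
          LinearMap.ker (covecAt η q).toLinearMap := by
        rintro _ ⟨w, rfl⟩
        exact hker w
      -- The tangent space lies in ker η and both have dimension n, so they coincide.
      have hrange := Submodule.eq_of_le_of_finrank_eq hle (by
        rw [H.finrank_ker_form, LinearMap.finrank_range_of_inj hinj, finrank_euclideanSpace_fin])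
      exact hrange }

theorem range_leafThrough (p : L) :
    range (H.leafThrough p).incl = connectedComponent (α := LeafSpace H) p :=
  Subtype.range_val

theorem mem_range_leafThrough (p : L) : p ∈ range (H.leafThrough p).incl := by
  rw [range_leafThrough]
  exact mem_connectedComponent (α := LeafSpace H)

/-- An integral manifold is connected and its inclusion is continuous for the leaf topology, so its
image lies in a single component of that topology. -/
theorem isLeaf_leafThrough (p : L) : (H.leafThrough p).IsLeaf := by
  intro Q hQ
  rw [range_leafThrough] at hQ ⊢
  have hc : Continuous (Y := LeafSpace H) Q.incl := by
    refine H.continuous_leafSpace (F := EuclideanSpace ℝ (Fin n)) Q.immersion.contMDiff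
      fun s w => ?_
    have : mfderiv (𝓡 n) (𝓡 (n + 1)) Q.incl s w ∈
        LinearMap.ker (η (Q.incl s)).toLinearMap := by
      rw [← Q.tangent s]
      exact ⟨w, rfl⟩
    exact this
  obtain ⟨x, hx, hx'⟩ := hQ
  rw [connectedComponent_eq (α := LeafSpace H) hx']
  exact (isPreconnected_range hc).subset_connectedComponent hx

end IsUnitClosedForm

/-! ### Linear algebra of a degenerate hyperplane in a Lorentzian space. -/

section LorentzianAlgebra

variable {E F : Type*} [NormedAddCommGroup E] [NormedSpace ℝ E] [NormedAddCommGroup F]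
  [NormedSpace ℝ F] {G : F →L[ℝ] F →L[ℝ] ℝ} {D : E →L[ℝ] F} {z : F}

theorem eq_zero_of_signature (hsig : ∃ t, G t t < 0 ∧ ∀ a, G t a = 0 → a ≠ 0 → 0 < G a a) {v : F}
    (hv : ∀ w, G v w = 0) (hv' : ∀ w, G w v = 0) : v = 0 := by
  obtain ⟨t, -, ht⟩ := hsig
  by_contra h0
  exact (ht v (hv' t) h0).ne' (hv v)

theorem exists_eq_map_add_smul [FiniteDimensional ℝ E] [FiniteDimensional ℝ F]
    (hdim : Module.finrank ℝ F = Module.finrank ℝ E + 1)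
    (hD : Function.Injective D) (hz : ∀ a, D a ≠ z) (v : F) : ∃ a, ∃ c : ℝ, v = D a + c • z := by
  let T : E × ℝ →ₗ[ℝ] F := D.toLinearMap.coprod (LinearMap.toSpanSingleton ℝ F z)
  have hT : Function.Injective T := by
    refine (injective_iff_map_eq_zero _).2 ?_
    rintro ⟨a, c⟩ h
    have h' : D a + c • z = 0 := h
    have hc : c = 0 := by
      by_contra hc
      refine hz (-c⁻¹ • a) ?_
      rw [map_smul, eq_neg_of_add_eq_zero_left h', neg_smul_neg, inv_smul_smul₀ hc]
    subst hc
    rw [zero_smul, add_zero] at h'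
    rw [(map_eq_zero_iff _ hD).1 h', Prod.mk_zero_zero]
  have hs := (LinearMap.injective_iff_surjective_of_finrank_eq_finrank (f := T)
    (by rw [hdim, Module.finrank_prod, Module.finrank_self])).1 hT
  obtain ⟨⟨a, c⟩, h⟩ := hs v
  exact ⟨a, c, h.symm⟩

/-- A degenerate direction cannot be orthogonal to the transversal `z`, for it would then be
orthogonal to the whole space. Rescaling it gives the value of the rigged field. -/
theorem exists_null_normalized [FiniteDimensional ℝ E] [FiniteDimensional ℝ F]
    (hdim : Module.finrank ℝ F = Module.finrank ℝ E + 1)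
    (hsymm : ∀ a b, G a b = G b a)
    (hsig : ∃ t, G t t < 0 ∧ ∀ a, G t a = 0 → a ≠ 0 → 0 < G a a)
    (hD : Function.Injective D) (hz : ∀ a, D a ≠ z)
    (hdeg : ∃ a, a ≠ 0 ∧ ∀ b, G (D a) (D b) = 0) :
    ∃ r, G z (D r) = 1 ∧ ∀ b, G (D r) (D b) = 0 := by
  obtain ⟨a, ha, hab⟩ := hdeg
  have hza : G z (D a) ≠ 0 := by
    intro h0
    refine ha ((map_eq_zero_iff _ hD).1 ?_)
    have key : ∀ w, G (D a) w = 0 := by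
      intro w
      obtain ⟨b, c, rfl⟩ := exists_eq_map_add_smul hdim hD hz w
      rw [map_add, map_smul, hab, hsymm, h0, smul_zero, add_zero]
    exact eq_zero_of_signature hsig key fun w => (hsymm _ _).trans (key w)
  refine ⟨(G z (D a))⁻¹ • a, ?_, fun b => ?_⟩
  · rw [map_smul, map_smul, smul_eq_mul, inv_mul_cancel₀ hza]
  · rw [map_smul, map_smul, smul_apply, hab, smul_zero]

/-- Moving `w` along the null direction does not change G(Dw, Dw) and can make it orthogonal to the
timelike `t`, where G is positive. Only multiples of `r` remain, and on those the square is
positive. -/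
theorem add_sq_pos_of_null (hsymm : ∀ a b, G a b = G b a)
    (hsig : ∃ t, G t t < 0 ∧ ∀ a, G t a = 0 → a ≠ 0 → 0 < G a a) (hD : Function.Injective D)
    {r : E} (hr : G z (D r) = 1) (hnull : ∀ b, G (D r) (D b) = 0) {w : E} (hw : w ≠ 0) :
    0 < G (D w) (D w) + G z (D w) * G z (D w) := by
  obtain ⟨t, -, ht⟩ := hsig
  have hr0 : D r ≠ 0 := by
    intro h
    rw [h, map_zero] at hr
    exact zero_ne_one hr
  have htr : G t (D r) ≠ 0 := fun h => (ht _ h hr0).ne' (hnull r)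
  -- Chosen so that w - c r maps into the orthogonal of `t`; the denominator is nonzero because a
  -- nonzero null vector is not orthogonal to `t`.
  set c := G t (D w) / G t (D r) with hc
  have h1 : G t (D (w - c • r)) = 0 := by
    rw [map_sub, map_sub, map_smul, map_smul, smul_eq_mul, hc]
    field_simp
    ring
  have h2 : G (D (w - c • r)) (D (w - c • r)) = G (D w) (D w) := by
    have := hsymm (D w) (D r)
    simp only [map_sub, map_smul, sub_apply, smul_apply, smul_eq_mul, hnull, this]
    ring
  by_cases h3 : w - c • r = 0
  · have hwc : w = c • r := sub_eq_zero.1 h3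
    have hc0 : c ≠ 0 := by
      rintro h
      rw [h, zero_smul] at hwc
      exact hw hwc
    rw [hwc]
    simp only [map_smul, smul_apply, hnull, hr, smul_eq_mul, mul_one, mul_zero, zero_add]
    exact mul_self_pos.2 hc0
  · have := ht _ h1 ((map_ne_zero_iff _ hD).2 h3)
    rw [h2] at this
    exact add_pos_of_pos_of_nonneg this (mul_self_nonneg _)

end LorentzianAlgebra

/-! ### Smoothness of pairings and of the metric dual. -/

section Pairing

variable {E : Type*} [NormedAddCommGroup E] [NormedSpace ℝ E]
  {M : Type*} [TopologicalSpace M] [ChartedSpace E M] [IsManifold 𝓘(ℝ, E) ∞ M]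
  {F : Type*} [NormedAddCommGroup F] [NormedSpace ℝ F]
  {N : Type*} [TopologicalSpace N] [ChartedSpace F N]

theorem LorentzianMetric.contMDiffAt_apply (g : LorentzianMetric E M) {φ : N → M}
    {A B : ∀ q, TangentSpace 𝓘(ℝ, E) (φ q)} {p : N}
    (hA : ContMDiffAt 𝓘(ℝ, F) 𝓘(ℝ, E).tangent ∞
      (fun q => (⟨φ q, A q⟩ : TangentBundle 𝓘(ℝ, E) M)) p)
    (hB : ContMDiffAt 𝓘(ℝ, F) 𝓘(ℝ, E).tangent ∞
      (fun q => (⟨φ q, B q⟩ : TangentBundle 𝓘(ℝ, E) M)) p) :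
    ContMDiffAt 𝓘(ℝ, F) 𝓘(ℝ, ℝ) ∞
      (fun q => bilinAt g.val (φ q) (vecAt _ (A q)) (vecAt _ (B q))) p := by
  have hφ : ContMDiffAt 𝓘(ℝ, F) 𝓘(ℝ, E) ∞ φ p :=
    ((Bundle.contMDiff_proj (IB := 𝓘(ℝ, E)) (F := E)
      (TangentSpace 𝓘(ℝ, E) : M → Type _)) _).comp p hA
  have : ContMDiffAt 𝓘(ℝ, F) (𝓘(ℝ, E).prod 𝓘(ℝ)) ∞
      (fun q => Bundle.TotalSpace.mk' ℝ (E := Bundle.Trivial M ℝ) (φ q)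
        (g.val (φ q) (A q) (B q))) p :=
    ContMDiffAt.clm_bundle_apply₂ (F₁ := E) (F₂ := E)
      (ContMDiffAt.comp p (g.contMDiff _) hφ) hA hB
  rw [Bundle.contMDiffAt_totalSpace] at this
  exact this.2

end Pairing

section Invertible

variable {E : Type*} [NormedAddCommGroup E] [NormedSpace ℝ E] [FiniteDimensional ℝ E]
  {L : Type*} [TopologicalSpace L] [ChartedSpace E L] [IsManifold 𝓘(ℝ, E) ∞ L]

theorem isInvertible_metricInChart {h : BilinField E L}
    (hpos : ∀ (p : L) (a : E), a ≠ 0 → 0 < bilinAt h p a a) {x : L} {y : E}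
    (hy : y ∈ (extChartAt 𝓘(ℝ, E) x).target) : (metricInChart h x y).IsInvertible := by
  refine isInvertible_of_nondegenerate _ fun a ha => ?_
  by_contra h0
  have h1 := hpos ((extChartAt 𝓘(ℝ, E) x).symm y) (dSymm x y a) fun h => by
    have := dChart_dSymm hy a
    rw [h, map_zero] at this
    exact h0 this.symm
  rw [← metricInChart_apply, ha] at h1
  exact h1.false

/-- Exhibits the components of ξ as the inverse metric applied to η, so that smoothness of ξ follows
from smoothness of operator inversion. -/
theorem comps_eq_inverse {h : BilinField E L} {η : CovectorField E L}
    {ξ : ∀ p : L, TangentSpace 𝓘(ℝ, E) p}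
    (hpos : ∀ (p : L) (a : E), a ≠ 0 → 0 < bilinAt h p a a)
    (hdual : ∀ (p : L) (a : E), bilinAt h p (vecAt p (ξ p)) a = covecAt η p a) {x q : L}
    (hq : q ∈ (chartAt E x).source) : comps (f := fun q => q) x ξ q =
      (metricInChart h x (extChartAt 𝓘(ℝ, E) x q)).inverse
        (covectorInChart η x (extChartAt 𝓘(ℝ, E) x q)) := by
  have hq' : q ∈ (extChartAt 𝓘(ℝ, E) x).source := by simpa using hq
  refine ((isInvertible_metricInChart hpos
    ((extChartAt 𝓘(ℝ, E) x).map_source hq')).inverse_apply_eq.2 ?_).symm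
  ext b
  rw [metricInChart_apply, comps, dSymm_dChart hq, (extChartAt 𝓘(ℝ, E) x).left_inv hq',
    hdual, covectorInChart_apply, (extChartAt 𝓘(ℝ, E) x).left_inv hq']

end Invertible

/-! ### The rigged metric is Riemannian and the rigged field is smooth. -/

section Hypersurface

universe u v

variable {n : ℕ} {M : Type u} [TopologicalSpace M]
  [ChartedSpace (EuclideanSpace ℝ (Fin (n + 2))) M] [IsManifold (𝓡 (n + 2)) ∞ M]
  {L : Type v} [TopologicalSpace L] [ChartedSpace (EuclideanSpace ℝ (Fin (n + 1))) L]
  [IsManifold (𝓡 (n + 1)) ∞ L]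
  {g : LorentzianMetric (EuclideanSpace ℝ (Fin (n + 2))) M} {i : L → M}
  (hL : IsLightlikeHypersurface g i) (ζ : Rigging n i)

theorem IsLightlikeHypersurface.contMDiff (hL : IsLightlikeHypersurface g i) :
    ContMDiff (𝓡 (n + 1)) (𝓡 (n + 2)) ∞ i := hL.immersion.contMDiff

theorem IsLightlikeHypersurface.dMap_injective (hL : IsLightlikeHypersurface g i) (p : L) :
    Function.Injective (dMap (F := EuclideanSpace ℝ (Fin (n + 1)))
      (E := EuclideanSpace ℝ (Fin (n + 2))) i p) :=
  dMap_injective_of_isImmersionAt (hL.immersion.isImmersionAt p)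

namespace Rigging

/-- The rigging at a point of the hypersurface, as an element of the model space. -/
def vec (p : L) : EuclideanSpace ℝ (Fin (n + 2)) := vecAt (i p) (ζ.field (i p))

theorem map_ne_vec (p : L) (a : EuclideanSpace ℝ (Fin (n + 1))) :
    dMap (E := EuclideanSpace ℝ (Fin (n + 2))) i p a ≠ ζ.vec p :=
  fun h => ζ.not_tangent p ⟨a, h⟩

theorem riggedMetric_apply (p : L) (a b : EuclideanSpace ℝ (Fin (n + 1))) :
    bilinAt (ζ.riggedMetric g) p a b = bilinAt g.val (i p) (dMap i p a) (dMap i p b) +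
      covecAt (ζ.omega g) p a * covecAt (ζ.omega g) p b := rfl

include hL

theorem exists_eq_map_add_smul_vec (p : L) (v : EuclideanSpace ℝ (Fin (n + 2))) :
    ∃ a : EuclideanSpace ℝ (Fin (n + 1)), ∃ c : ℝ, v = dMap i p a + c • ζ.vec p :=
  exists_eq_map_add_smul (by simp) (hL.dMap_injective p) (ζ.map_ne_vec p) v

theorem exists_null (p : L) : ∃ r : EuclideanSpace ℝ (Fin (n + 1)), covecAt (ζ.omega g) p r = 1 ∧
    ∀ b : EuclideanSpace ℝ (Fin (n + 1)),
      bilinAt g.val (i p) (dMap i p r) (dMap i p b) = 0 :=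
  exists_null_normalized (by simp) (g.symm (i p)) (g.signature (i p)) (hL.dMap_injective p)
    (ζ.map_ne_vec p) (hL.degenerate p)

theorem riggedMetric_pos (p : L) {a : EuclideanSpace ℝ (Fin (n + 1))} (ha : a ≠ 0) :
    0 < bilinAt (ζ.riggedMetric g) p a a := by
  obtain ⟨r, hr, hr'⟩ := ζ.exists_null hL p
  exact add_sq_pos_of_null (g.symm (i p)) (g.signature (i p)) (hL.dMap_injective p) hr hr' ha

theorem riggedMetric_isInvertible (p : L) : (bilinAt (ζ.riggedMetric g) p).IsInvertible := by
  refine isInvertible_of_nondegenerate _ fun a ha => ?_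
  by_contra h0
  exact (ζ.riggedMetric_pos hL p h0).ne' (ha a)

theorem riggedMetric_rigged (p : L) (a : EuclideanSpace ℝ (Fin (n + 1))) :
    bilinAt (ζ.riggedMetric g) p (vecAt p (ζ.rigged g p)) a = covecAt (ζ.omega g) p a :=
  DFunLike.congr_fun ((ζ.riggedMetric_isInvertible hL p).self_apply_inverse _) a

/-- Both vectors have the same g̃-dual: the g-part vanishes on the null vector and ω⊗ω contributes
ω. This transfers the properties of the abstract null vector to ξ. -/
theorem rigged_eq {p : L} {r : EuclideanSpace ℝ (Fin (n + 1))} (hr : covecAt (ζ.omega g) p r = 1)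
    (hr' : ∀ b : EuclideanSpace ℝ (Fin (n + 1)),
      bilinAt g.val (i p) (dMap i p r) (dMap i p b) = 0) :
    vecAt p (ζ.rigged g p) = r := by
  refine (ζ.riggedMetric_isInvertible hL p).injective ?_
  ext b
  rw [ζ.riggedMetric_rigged hL, riggedMetric_apply, hr, hr', zero_add, one_mul]

theorem omega_rigged (p : L) : covecAt (ζ.omega g) p (vecAt p (ζ.rigged g p)) = 1 := by
  obtain ⟨r, hr, hr'⟩ := ζ.exists_null hL p
  rwa [ζ.rigged_eq hL hr hr']

theorem metric_rigged (p : L) (b : EuclideanSpace ℝ (Fin (n + 1))) :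
    bilinAt g.val (i p) (dMap i p (vecAt p (ζ.rigged g p))) (dMap i p b) = 0 := by
  obtain ⟨r, hr, hr'⟩ := ζ.exists_null hL p
  rw [ζ.rigged_eq hL hr hr', hr']

theorem contMDiffAt_vec (p : L) : ContMDiffAt (𝓡 (n + 1)) (𝓡 (n + 2)).tangent ∞
    (fun q : L => (⟨i q, ζ.field (i q)⟩ : TangentBundle (𝓡 (n + 2)) M)) p :=
  ContMDiffAt.comp p
    (ζ.smoothOn.contMDiffAt (ζ.isOpen_dom.mem_nhds (ζ.range_subset (mem_range_self p))))
    (hL.contMDiff p)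

theorem contDiffAt_omegaInChart (x : L) (y : EuclideanSpace ℝ (Fin (n + 1)))
    (hy : y ∈ (extChartAt (𝓡 (n + 1)) x).target) :
    ContDiffAt ℝ ∞ (covectorInChart (ζ.omega g) x) y := by
  refine contDiffAt_clm_apply_iff.2 fun a => contMDiffAt_iff_contDiffAt.1 ?_
  exact g.contMDiffAt_apply
    (ContMDiffAt.comp y (ζ.contMDiffAt_vec hL _) (contMDiffAt_chart_symm hy))
    (contMDiffAt_push_frame hL.contMDiff hy a)

theorem contDiffAt_riggedMetricInChart (x : L) (y : EuclideanSpace ℝ (Fin (n + 1)))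
    (hy : y ∈ (extChartAt (𝓡 (n + 1)) x).target) :
    ContDiffAt ℝ ∞ (metricInChart (ζ.riggedMetric g) x) y := by
  refine contDiffAt_clm_apply_iff.2 fun a => contDiffAt_clm_apply_iff.2 fun b => ?_
  have h1 := contMDiffAt_iff_contDiffAt.1 (g.contMDiffAt_apply
    (contMDiffAt_push_frame hL.contMDiff hy a) (contMDiffAt_push_frame hL.contMDiff hy b))
  have h2 := ζ.contDiffAt_omegaInChart hL x y hy
  exact h1.add ((h2.clm_apply contDiffAt_const).mul (h2.clm_apply contDiffAt_const))

theorem isSmoothField_rigged : IsSmoothField (ζ.rigged g) := by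
  intro p
  refine (contMDiffAt_along_iff (f := fun q : L => q) (x := p) continuousAt_id (by simp)).2
    ⟨contMDiffAt_id, ?_⟩
  have hp := mem_extChartAt_target (I := 𝓡 (n + 1)) p
  have hinv : (metricInChart (ζ.riggedMetric g) p (extChartAt (𝓡 (n + 1)) p p)).IsInvertible := by
    rw [metricInChart_self]
    exact ζ.riggedMetric_isInvertible hL p
  have h1 : ContDiffAt ℝ ∞ (fun y => (metricInChart (ζ.riggedMetric g) p y).inverse
      (covectorInChart (ζ.omega g) p y)) (extChartAt (𝓡 (n + 1)) p p) :=
    (ContDiffAt.comp _ hinv.contDiffAt_map_inverse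
      (ζ.contDiffAt_riggedMetricInChart hL p _ hp)).clm_apply (ζ.contDiffAt_omegaInChart hL p _ hp)
  have h2 := ContMDiffAt.comp (I' := 𝓡 (n + 1)) p (contMDiffAt_iff_contDiffAt.2 h1)
    (contMDiffAt_extChartAt (I := 𝓡 (n + 1)))
  refine h2.congr_of_eventuallyEq ?_
  filter_upwards [(chartAt (EuclideanSpace ℝ (Fin (n + 1))) p).open_source.mem_nhds
    (mem_chart_source _ p)] with q hq
  exact comps_eq_inverse (fun q a ha => ζ.riggedMetric_pos hL q ha) (ζ.riggedMetric_rigged hL) hq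

end Rigging

end Hypersurface

/-! ### Pullback of forms and metrics in charts. -/

section Pullback

variable {E : Type*} [NormedAddCommGroup E] [NormedSpace ℝ E]
  {M : Type*} [TopologicalSpace M] [ChartedSpace E M] [IsManifold 𝓘(ℝ, E) ∞ M]
  {F : Type*} [NormedAddCommGroup F] [NormedSpace ℝ F]
  {N : Type*} [TopologicalSpace N] [ChartedSpace F N] [IsManifold 𝓘(ℝ, F) ∞ N]
  {f : N → M}

theorem fderiv_covectorInChart_symm {α : CovectorField E M} {x : M}
    (hα : ∀ a b : TangentSpace 𝓘(ℝ, E) x, extDerivOne α x a b = 0) (a b : E) :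
    fderiv ℝ (covectorInChart α x) (extChartAt 𝓘(ℝ, E) x x) a b =
      fderiv ℝ (covectorInChart α x) (extChartAt 𝓘(ℝ, E) x x) b a :=
  sub_eq_zero.1 (hα a b)

theorem metricInChart_chartRep (hf : ContMDiff 𝓘(ℝ, F) 𝓘(ℝ, E) ∞ f) (g : BilinField E M)
    {p : N} {x : M} {y : F} (hy : y ∈ (extChartAt 𝓘(ℝ, F) p).target)
    (hx : f ((extChartAt 𝓘(ℝ, F) p).symm y) ∈ (chartAt E x).source) (a b : F) :
    metricInChart g x (chartRep (E := E) f p x y) (fderiv ℝ (chartRep (E := E) f p x) y a)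
        (fderiv ℝ (chartRep (E := E) f p x) y b) =
      bilinAt g (f ((extChartAt 𝓘(ℝ, F) p).symm y))
        (dMap f ((extChartAt 𝓘(ℝ, F) p).symm y) (dSymm p y a))
        (dMap f ((extChartAt 𝓘(ℝ, F) p).symm y) (dSymm p y b)) := by
  have h : ∀ a, dSymm x (chartRep (E := E) f p x y) (fderiv ℝ (chartRep (E := E) f p x) y a) =
      dMap f ((extChartAt 𝓘(ℝ, F) p).symm y) (dSymm p y a) :=
    fun a => mfderiv_symm_fderiv_chartRep hf hy hx a
  rw [metricInChart_apply, h, h, symm_chartRep hx]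

theorem covectorInChart_chartRep (hf : ContMDiff 𝓘(ℝ, F) 𝓘(ℝ, E) ∞ f) (α : CovectorField E M)
    {p : N} {x : M} {y : F} (hy : y ∈ (extChartAt 𝓘(ℝ, F) p).target)
    (hx : f ((extChartAt 𝓘(ℝ, F) p).symm y) ∈ (chartAt E x).source) (a : F) :
    covectorInChart α x (chartRep (E := E) f p x y) (fderiv ℝ (chartRep (E := E) f p x) y a) =
      covecAt α (f ((extChartAt 𝓘(ℝ, F) p).symm y))
        (dMap f ((extChartAt 𝓘(ℝ, F) p).symm y) (dSymm p y a)) := by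
  have h : ∀ a, dSymm x (chartRep (E := E) f p x y) (fderiv ℝ (chartRep (E := E) f p x) y a) =
      dMap f ((extChartAt 𝓘(ℝ, F) p).symm y) (dSymm p y a) :=
    fun a => mfderiv_symm_fderiv_chartRep hf hy hx a
  rw [covectorInChart_apply, h, symm_chartRep hx]

theorem eventually_mem_chart (hf : ContMDiff 𝓘(ℝ, F) 𝓘(ℝ, E) ∞ f) {p : N} {x : M} {y : F}
    (hy : y ∈ (extChartAt 𝓘(ℝ, F) p).target)
    (hx : f ((extChartAt 𝓘(ℝ, F) p).symm y) ∈ (chartAt E x).source) :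
    ∀ᶠ z in 𝓝 y, z ∈ (extChartAt 𝓘(ℝ, F) p).target ∧
      f ((extChartAt 𝓘(ℝ, F) p).symm z) ∈ (chartAt E x).source :=
  Filter.Eventually.and (extChartAt_target_mem_nhds_self hy)
    (((hf _).continuousAt.comp (contMDiffAt_chart_symm hy).continuousAt).preimage_mem_nhds
      ((chartAt E x).open_source.mem_nhds hx))

theorem hasFDerivAt_fderiv_chartRep (hf : ContMDiff 𝓘(ℝ, F) 𝓘(ℝ, E) ∞ f) {p : N} {x : M} {y : F}
    (hy : y ∈ (extChartAt 𝓘(ℝ, F) p).target)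
    (hx : f ((extChartAt 𝓘(ℝ, F) p).symm y) ∈ (chartAt E x).source) :
    HasFDerivAt (fderiv ℝ (chartRep (E := E) f p x))
      (fderiv ℝ (fderiv ℝ (chartRep (E := E) f p x)) y) y :=
  (((contDiffAt_chartRep hf hy hx).fderiv_right (m := 1)
    (by norm_num; exact ENat.LEInfty.out)).differentiableAt
    (by norm_num)).hasFDerivAt

theorem fderiv_fderiv_chartRep_symm (hf : ContMDiff 𝓘(ℝ, F) 𝓘(ℝ, E) ∞ f) {p : N} {x : M} {y : F}
    (hy : y ∈ (extChartAt 𝓘(ℝ, F) p).target)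
    (hx : f ((extChartAt 𝓘(ℝ, F) p).symm y) ∈ (chartAt E x).source) (a b : F) :
    fderiv ℝ (fderiv ℝ (chartRep (E := E) f p x)) y a b =
      fderiv ℝ (fderiv ℝ (chartRep (E := E) f p x)) y b a :=
  (contDiffAt_chartRep hf hy hx).isSymmSndFDerivAt
    (by simp; exact ENat.LEInfty.out) a b

/-- The components of `df V` in a chart. -/
theorem fderiv_chartRep_compsInChart (hf : ContMDiff 𝓘(ℝ, F) 𝓘(ℝ, E) ∞ f)
    (V : ∀ q : N, TangentSpace 𝓘(ℝ, F) q) {p : N} {x : M} {y : F}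
    (hy : y ∈ (extChartAt 𝓘(ℝ, F) p).target)
    (hx : f ((extChartAt 𝓘(ℝ, F) p).symm y) ∈ (chartAt E x).source) :
    comps x (pushField (E := E) f V) ((extChartAt 𝓘(ℝ, F) p).symm y) =
      fderiv ℝ (chartRep (E := E) f p x) y (compsInChart p V y) := by
  rw [fderiv_chartRep hf hy hx]
  have hz : (extChartAt 𝓘(ℝ, F) p).symm y ∈ (chartAt F p).source := by
    simpa using (extChartAt 𝓘(ℝ, F) p).map_target hy
  have h := dSymm_dChart hz (vecAt _ (V ((extChartAt 𝓘(ℝ, F) p).symm y)))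
  rw [(extChartAt 𝓘(ℝ, F) p).right_inv hy] at h
  change dChart E x _ (dMap f _ (vecAt _ (V _))) = dChart E x _ (dMap f _ (dSymm p y
    (dChart F p _ (vecAt _ (V _)))))
  rw [h]

end Pullback

/-! ### Closedness of ω. -/

section Hypersurface

universe u v

variable {n : ℕ} {M : Type u} [TopologicalSpace M]
  [ChartedSpace (EuclideanSpace ℝ (Fin (n + 2))) M] [IsManifold (𝓡 (n + 2)) ∞ M]
  {L : Type v} [TopologicalSpace L] [ChartedSpace (EuclideanSpace ℝ (Fin (n + 1))) L]
  [IsManifold (𝓡 (n + 1)) ∞ L]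
  {g : LorentzianMetric (EuclideanSpace ℝ (Fin (n + 2))) M} {i : L → M}
  (hL : IsLightlikeHypersurface g i) (ζ : Rigging n i) (hζ : ζ.IsClosed g)

theorem LorentzianMetric.nondegenerate
    (g : LorentzianMetric (EuclideanSpace ℝ (Fin (n + 2))) M) (x : M)
    (a : EuclideanSpace ℝ (Fin (n + 2))) (ha : ∀ c, bilinAt g.val x a c = 0) : a = 0 :=
  eq_zero_of_signature (G := bilinAt g.val x) (g.signature x) ha fun c => (g.symm x c a).trans (ha c)

theorem LorentzianMetric.differentiableAt_metricInChart
    (g : LorentzianMetric (EuclideanSpace ℝ (Fin (n + 2))) M) (x : M) :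
    DifferentiableAt ℝ (metricInChart g.val x) (extChartAt (𝓡 (n + 2)) x x) := by
  have h : ContDiffAt ℝ ∞ (metricInChart g.val x) (extChartAt (𝓡 (n + 2)) x x) := ?_
  · exact h.differentiableAt (by norm_num)
  refine contDiffAt_clm_apply_iff.2 fun a => contDiffAt_clm_apply_iff.2 fun b => ?_
  exact contMDiffAt_iff_contDiffAt.1 (g.contMDiffAt_apply
    (contMDiffAt_frame (mem_extChartAt_target x) a) (contMDiffAt_frame (mem_extChartAt_target x) b))

namespace Rigging

include hL hζ

theorem differentiableAt_alphaInChart (q : L) :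
    DifferentiableAt ℝ (covectorInChart (ζ.alpha g) (i q)) (extChartAt (𝓡 (n + 2)) (i q) (i q)) := by
  have h : ContDiffAt ℝ ∞ (covectorInChart (ζ.alpha g) (i q))
      (extChartAt (𝓡 (n + 2)) (i q) (i q)) := ?_
  · exact h.differentiableAt (by norm_num)
  refine contDiffAt_clm_apply_iff.2 fun a => ?_
  have h1 := contMDiffAt_frame (mem_extChartAt_target (I := 𝓡 (n + 2)) (i q)) a
  have h2 := contMDiffAt_chart_symm (mem_extChartAt_target (I := 𝓡 (n + 2)) (i q))
  have h3 := ζ.smoothOn.contMDiffAt (ζ.isOpen_dom.mem_nhds (ζ.range_subset (mem_range_self q)))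
  rw [← extChartAt_to_inv (I := 𝓡 (n + 2)) (i q)] at h3
  exact contMDiffAt_iff_contDiffAt.1 (g.contMDiffAt_apply (ContMDiffAt.comp _ h3 h2) h1)

/-- The exterior derivative commutes with pullback: the extra term carries the second derivative of
`i`, which is symmetric. Closedness of α is given at each point in the preferred chart at that
point, so the target chart is taken at `i q` while the source chart stays at `x`. -/
theorem omega_closed (x : L) (y : EuclideanSpace ℝ (Fin (n + 1)))
    (hy : y ∈ (extChartAt (𝓡 (n + 1)) x).target) (a b : EuclideanSpace ℝ (Fin (n + 1))) :
    fderiv ℝ (covectorInChart (ζ.omega g) x) y a b =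
      fderiv ℝ (covectorInChart (ζ.omega g) x) y b a := by
  set q := (extChartAt (𝓡 (n + 1)) x).symm y with hq
  have hi := hL.contMDiff
  have hx : i ((extChartAt (𝓡 (n + 1)) x).symm y) ∈
      (chartAt (EuclideanSpace ℝ (Fin (n + 2))) (i q)).source := mem_chart_source _ _
  have hα := (ζ.differentiableAt_alphaInChart hL hζ q).hasFDerivAt
  have hr := ((contDiffAt_chartRep hi hy hx).differentiableAt (by norm_num)).hasFDerivAt
  have hval : chartRep i x (i q) y = extChartAt (𝓡 (n + 2)) (i q) (i q) := rfl
  rw [← hval] at hα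
  have hd2 := hasFDerivAt_fderiv_chartRep hi hy hx
  have key : ∀ u c, fderiv ℝ (covectorInChart (ζ.omega g) x) y u c =
      fderiv ℝ (covectorInChart (ζ.alpha g) (i q)) (extChartAt (𝓡 (n + 2)) (i q) (i q))
        (fderiv ℝ (chartRep i x (i q)) y u) (fderiv ℝ (chartRep i x (i q)) y c) +
      covecAt (ζ.alpha g) (i q) (fderiv ℝ (fderiv ℝ (chartRep i x (i q))) y u c) := by
    intro u c
    have h1 := (hα.comp y hr).clm_apply (hd2.clm_apply (hasFDerivAt_const c _))
    have h2 := ((ζ.contDiffAt_omegaInChart hL x y hy).differentiableAt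
      (by norm_num)).hasFDerivAt.clm_apply (hasFDerivAt_const c _)
    have heq : (fun z => covectorInChart (ζ.omega g) x z c) =ᶠ[𝓝 y] fun z =>
        (covectorInChart (ζ.alpha g) (i q) ∘ chartRep i x (i q)) z
          (fderiv ℝ (chartRep i x (i q)) z c) := by
      filter_upwards [eventually_mem_chart hi hy hx] with z hz
      exact (covectorInChart_chartRep hi (ζ.alpha g) hz.1 hz.2 c).symm
    have h3 := DFunLike.congr_fun (h2.unique (h1.congr_of_eventuallyEq heq)) u
    simp only [Function.comp_apply, hval, covectorInChart_self, add_apply,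
      ContinuousLinearMap.flip_apply, ContinuousLinearMap.comp_apply, zero_apply, map_zero,
      zero_add] at h3
    rw [h3, add_comm]
  rw [key, key, fderiv_fderiv_chartRep_symm hi hy hx a b,
    fderiv_covectorInChart_symm (hζ (i q) (ζ.range_subset (mem_range_self q)))]

theorem isUnitClosedForm : IsUnitClosedForm (ζ.riggedMetric g) (ζ.omega g) (ζ.rigged g) where
  metric_contDiffAt := ζ.contDiffAt_riggedMetricInChart hL
  symm p a b := by
    rw [riggedMetric_apply, riggedMetric_apply, mul_comm]
    exact congrArg (· + _) (g.symm (i p) _ _)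
  pos p _ ha := ζ.riggedMetric_pos hL p ha
  form_contDiffAt := ζ.contDiffAt_omegaInChart hL
  closed := ζ.omega_closed hL hζ
  dual := ζ.riggedMetric_rigged hL
  unit := ζ.omega_rigged hL
  smooth := ζ.isSmoothField_rigged hL

end Rigging

end Hypersurface

/-! ### The second fundamental form of the hypersurface is -∇̃ω. -/

section Hypersurface

universe u v

variable {n : ℕ} {M : Type u} [TopologicalSpace M]
  [ChartedSpace (EuclideanSpace ℝ (Fin (n + 2))) M] [IsManifold (𝓡 (n + 2)) ∞ M]
  {L : Type v} [TopologicalSpace L] [ChartedSpace (EuclideanSpace ℝ (Fin (n + 1))) L]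
  [IsManifold (𝓡 (n + 1)) ∞ L]
  {g : LorentzianMetric (EuclideanSpace ℝ (Fin (n + 2))) M} {i : L → M}
  (hL : IsLightlikeHypersurface g i) (ζ : Rigging n i) (hζ : ζ.IsClosed g)

/-- The second derivative of `i` at `p` in the preferred charts. -/
def secondDeriv (i : L → M) (p : L) (u v : EuclideanSpace ℝ (Fin (n + 1))) :
    EuclideanSpace ℝ (Fin (n + 2)) :=
  fderiv ℝ (fderiv ℝ (chartRep i p (i p))) (extChartAt (𝓡 (n + 1)) p p) u v

include hL in
theorem mem_chart_extChartAt_self (p : L) :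
    i ((extChartAt (𝓡 (n + 1)) p).symm (extChartAt (𝓡 (n + 1)) p p)) ∈
      (chartAt (EuclideanSpace ℝ (Fin (n + 2))) (i p)).source := by
  rw [extChartAt_to_inv]
  exact mem_chart_source _ _

theorem chartRep_self (p : L) : chartRep i p (i p) (extChartAt (𝓡 (n + 1)) p p) =
    extChartAt (𝓡 (n + 2)) (i p) (i p) := by
  simp only [chartRep, Function.comp_apply, extChartAt_to_inv]

namespace Rigging

include hL

/-- The derivative of the rigged metric in terms of the derivative of the ambient metric. -/
theorem fderiv_riggedMetric (p : L) (u a b : EuclideanSpace ℝ (Fin (n + 1))) :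
    fderiv ℝ (metricInChart (ζ.riggedMetric g) p) (extChartAt (𝓡 (n + 1)) p p) u a b =
      fderiv ℝ (metricInChart g.val (i p)) (extChartAt (𝓡 (n + 2)) (i p) (i p))
        (dMap i p u) (dMap i p a) (dMap i p b) +
      bilinAt g.val (i p) (secondDeriv i p u a) (dMap i p b) +
      bilinAt g.val (i p) (dMap i p a) (secondDeriv i p u b) +
      fderiv ℝ (covectorInChart (ζ.omega g) p) (extChartAt (𝓡 (n + 1)) p p) u a *
        covecAt (ζ.omega g) p b +
      covecAt (ζ.omega g) p a *
        fderiv ℝ (covectorInChart (ζ.omega g) p) (extChartAt (𝓡 (n + 1)) p p) u b := by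
  have hi := hL.contMDiff
  have hy := mem_extChartAt_target (I := 𝓡 (n + 1)) p
  have hx := mem_chart_extChartAt_self hL p
  have hG := (g.differentiableAt_metricInChart (i p)).hasFDerivAt
  rw [← chartRep_self] at hG
  have hr := ((contDiffAt_chartRep hi hy hx).differentiableAt (by norm_num)).hasFDerivAt
  have hd := hasFDerivAt_fderiv_chartRep hi hy hx
  have hη := ((ζ.contDiffAt_omegaInChart hL p _ hy).differentiableAt (by norm_num)).hasFDerivAt
  have h1 := (((hG.comp _ hr).clm_apply (hd.clm_apply (hasFDerivAt_const a _))).clm_apply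
    (hd.clm_apply (hasFDerivAt_const b _))).add
    ((hη.clm_apply (hasFDerivAt_const a _)).mul (hη.clm_apply (hasFDerivAt_const b _)))
  have h2 := ((((ζ.contDiffAt_riggedMetricInChart hL p _ hy).differentiableAt
    (by norm_num)).hasFDerivAt.clm_apply (hasFDerivAt_const a _))).clm_apply (hasFDerivAt_const b _)
  have heq : (fun z => metricInChart (ζ.riggedMetric g) p z a b) =ᶠ[𝓝 (extChartAt (𝓡 (n + 1)) p p)]
      (fun z => (metricInChart g.val (i p) ∘ chartRep i p (i p)) z
        (fderiv ℝ (chartRep i p (i p)) z a) (fderiv ℝ (chartRep i p (i p)) z b)) +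
      fun z => covectorInChart (ζ.omega g) p z a * covectorInChart (ζ.omega g) p z b := by
    filter_upwards [eventually_mem_chart hi hy hx] with z hz
    exact congrArg (· + _) (metricInChart_chartRep hi g.val hz.1 hz.2 a b).symm
  have h3 := DFunLike.congr_fun (h2.unique (h1.congr_of_eventuallyEq heq)) u
  have hself : ∀ w, fderiv ℝ (chartRep i p (i p)) (extChartAt (𝓡 (n + 1)) p p) w = dMap i p w :=
    fderiv_chartRep_self hi p
  simp only [Function.comp_apply, chartRep_self, metricInChart_self, covectorInChart_self,
    add_apply, smul_apply, smul_eq_mul, hself,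
    ContinuousLinearMap.flip_apply, ContinuousLinearMap.comp_apply, zero_apply, map_zero,
    zero_add] at h3
  rw [h3]
  unfold secondDeriv
  ring

include hζ

/-- In the Koszul formula for g̃ tested against ξ, the ω⊗ω terms collapse, by closedness and ω(ξ) =
1, to the derivative of ω at (u, v), which T subtracts. The rest is the Koszul formula of g along
`i`, where symmetry of the second derivative leaves a single such term. -/
theorem negCovDeriv_eq (p : L) (u v : EuclideanSpace ℝ (Fin (n + 1))) :
    negCovDeriv (ζ.riggedMetric g) (ζ.omega g) p u v =
      bilinAt g.val (i p) (secondDeriv i p u v +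
        christoffel g.val (i p) (dMap i p u) (dMap i p v))
        (dMap i p (vecAt p (ζ.rigged g p))) := by
  have H := ζ.isUnitClosedForm hL hζ
  have hs : ∀ a b, secondDeriv i p a b = secondDeriv i p b a :=
    fderiv_fderiv_chartRep_symm hL.contMDiff (mem_extChartAt_target p)
      (mem_chart_extChartAt_self hL p)
  have hg : ∀ a b, bilinAt g.val (i p) a b = bilinAt g.val (i p) b a := g.symm (i p)
  have hc := H.closed p _ (mem_extChartAt_target p)
  rw [negCovDeriv, H.form_christoffel, map_add, add_apply,
    metric_christoffel g.val (i p) (g.nondegenerate (i p)), ζ.fderiv_riggedMetric hL,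
    ζ.fderiv_riggedMetric hL, ζ.fderiv_riggedMetric hL, H.unit, hs v u,
    hs (vecAt p (ζ.rigged g p)) u, hs (vecAt p (ζ.rigged g p)) v, hc v u,
    hc (vecAt p (ζ.rigged g p)) u, hc (vecAt p (ζ.rigged g p)) v,
    hg (secondDeriv i p u (vecAt p (ζ.rigged g p)))]
  ring

/-- The second fundamental form of `L` is `-∇ω` for the rigged metric. -/
theorem metric_covAlong_pushField {V : ∀ p : L, TangentSpace (𝓡 (n + 1)) p}
    (hV : IsSmoothField V) (p : L) (u : EuclideanSpace ℝ (Fin (n + 1))) :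
    bilinAt g.val (i p) (vecAt (i p) (covAlong g.val i (pushField i V) p u))
        (dMap i p (vecAt p (ζ.rigged g p))) =
      negCovDeriv (ζ.riggedMetric g) (ζ.omega g) p u (vecAt p (V p)) := by
  have hi := hL.contMDiff
  have hy := mem_extChartAt_target (I := 𝓡 (n + 1)) p
  have hx := mem_chart_extChartAt_self hL p
  have hsymm := extChartAt_to_inv (I := 𝓡 (n + 1)) p
  have hm : MDifferentiableAt (𝓡 (n + 1)) (𝓡 (n + 2)) (comps (i p)
      (pushField (E := EuclideanSpace ℝ (Fin (n + 2))) i V)) p :=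
    (contMDiffAt_comps (E := EuclideanSpace ℝ (Fin (n + 2))) (contMDiff_pushField hi hV p)
      (hi p).continuousAt (by simp)).mdifferentiableAt (by norm_num)
  have hv : DifferentiableAt ℝ (compsInChart p V) (extChartAt (𝓡 (n + 1)) p p) :=
    (contDiffAt_compsInChart hy (hV _)).differentiableAt (by norm_num)
  have h1 := (hasFDerivAt_fderiv_chartRep hi hy hx).clm_apply hv.hasFDerivAt
  have heq : comps (i p) (pushField (E := EuclideanSpace ℝ (Fin (n + 2))) i V) ∘ (extChartAt (𝓡 (n + 1)) p).symm
      =ᶠ[𝓝 (extChartAt (𝓡 (n + 1)) p p)]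
        fun z => fderiv ℝ (chartRep i p (i p)) z (compsInChart p V z) := by
    filter_upwards [eventually_mem_chart hi hy hx] with z hz
    exact fderiv_chartRep_compsInChart hi V hz.1 hz.2
  have hself : ∀ w, fderiv ℝ (chartRep i p (i p)) (extChartAt (𝓡 (n + 1)) p p) w = dMap i p w :=
    fderiv_chartRep_self hi p
  rw [covAlong_eq, dMap_eq_fderiv hm, (h1.congr_of_eventuallyEq heq).fderiv,
    ζ.negCovDeriv_eq hL hζ]
  simp only [add_apply, ContinuousLinearMap.comp_apply, ContinuousLinearMap.flip_apply, hself,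
    compsInChart_self, map_add]
  -- The part of ∇_U V that differentiates V inside `L` is tangent to `L`, hence orthogonal to ξ.
  have hnull : ∀ b, bilinAt g.val (i p) (dMap i p b) (dMap i p (vecAt p (ζ.rigged g p))) = 0 :=
    fun b => (g.symm (i p) _ _).trans (ζ.metric_rigged hL p b)
  rw [hnull, zero_add]
  rfl

/-- Pairing the decomposition of ∇_U V with ξ kills the tangential part and leaves the coefficient,
because g(N, ξ) = g(ζ, ξ) = ω(ξ) = 1. -/
theorem lightlikeB_eq (U : ∀ p : L, TangentSpace (𝓡 (n + 1)) p)
    {V : ∀ p : L, TangentSpace (𝓡 (n + 1)) p} (hV : IsSmoothField V) (p : L) :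
    ζ.lightlikeB g U V p =
      negCovDeriv (ζ.riggedMetric g) (ζ.omega g) p (vecAt p (U p)) (vecAt p (V p)) := by
  rw [← ζ.metric_covAlong_pushField hL hζ hV]
  set W := vecAt (i p) (covAlong g.val i (pushField i V) p (U p)) with hW
  set r := vecAt p (ζ.rigged g p) with hr
  set c := (1 / 2 : ℝ) * bilinAt g.val (i p) (ζ.vec p) (ζ.vec p) with hc
  have hex : ∃ b : ℝ, ∃ a : EuclideanSpace ℝ (Fin (n + 1)),
      dMap i p a = W - b • (ζ.vec p - c • dMap i p r) := by
    obtain ⟨a, b, hab⟩ := ζ.exists_eq_map_add_smul_vec hL p W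
    -- Splitting along ζ instead of N gives the same coefficient; the tangential part absorbs the
    -- multiple of ξ by which ζ and N differ.
    refine ⟨b, a + (b * c) • r, ?_⟩
    rw [hab, map_add, map_smul, smul_sub, smul_smul]
    abel
  have hspec := Classical.epsilon_spec (p := fun b : ℝ =>
    covAlong g.val i (pushField i V) p (U p) - b • ζ.transverse g p ∈
      tangentRange (F := EuclideanSpace ℝ (Fin (n + 1))) i p) hex
  obtain ⟨a, ha⟩ : ∃ a : EuclideanSpace ℝ (Fin (n + 1)),
      dMap i p a = W - ζ.lightlikeB g U V p • (ζ.vec p - c • dMap i p r) := hspec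
  have hnull : ∀ b, bilinAt g.val (i p) (dMap i p b) (dMap i p r) = 0 :=
    fun b => (g.symm (i p) _ _).trans (ζ.metric_rigged hL p b)
  have h1 : bilinAt g.val (i p) (ζ.vec p) (dMap i p r) = 1 := ζ.omega_rigged hL p
  have h2 := congrArg (fun w => bilinAt g.val (i p) w (dMap i p r)) ha
  simp only [map_sub, map_smul, sub_apply, smul_apply, hnull, h1, smul_eq_mul, mul_zero, sub_zero,
    mul_one] at h2
  exact (sub_eq_zero.1 h2.symm).symm

end Rigging

end Hypersurface

/-! ### Smoothness of -∇η and of the umbilicity factor. -/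

section Smoothness

variable {E : Type*} [NormedAddCommGroup E] [NormedSpace ℝ E]
  {L : Type*} [TopologicalSpace L] [ChartedSpace E L] [IsManifold 𝓘(ℝ, E) ∞ L]

/-- The derivative of a smooth function along a smooth vector field is smooth. -/
theorem contMDiff_dMap_apply {f : L → ℝ} (hf : ContMDiff 𝓘(ℝ, E) 𝓘(ℝ, ℝ) ∞ f)
    {V : ∀ q : L, TangentSpace 𝓘(ℝ, E) q} (hV : IsSmoothField V) :
    ContMDiff 𝓘(ℝ, E) 𝓘(ℝ, ℝ) ∞ (fun q => dMap (E := ℝ) f q (vecAt q (V q))) := by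
  intro p
  have h := contMDiffAt_comps (E := ℝ) (x := f p) (contMDiff_pushField (E := ℝ) hf hV p)
    (hf p).continuousAt (by simp)
  refine h.congr_of_eventuallyEq (Eventually.of_forall fun q => ?_)
  have hid : ∀ a : ℝ, dChart ℝ (f p) (f q) a = a := by
    intro a
    rw [dChart, extChartAt_model_space_eq_id, PartialEquiv.refl_coe, mfderiv_id]
    rfl
  exact (hid _).symm

theorem IsSmoothField.mlieBracket [CompleteSpace E] {U V : ∀ q : L, TangentSpace 𝓘(ℝ, E) q}
    (hU : IsSmoothField U) (hV : IsSmoothField V) :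
    IsSmoothField (VectorField.mlieBracket 𝓘(ℝ, E) U V) := by
  intro p
  have : IsManifold 𝓘(ℝ, E) (minSmoothness ℝ 2) L :=
    IsManifold.of_le (n := ∞) (by simp; exact ENat.LEInfty.out)
  have : IsManifold 𝓘(ℝ, E) ((⊤ : ℕ∞) + 1) L := inferInstanceAs (IsManifold 𝓘(ℝ, E) ∞ L)
  exact ContMDiffAt.mlieBracket_vectorField (m := ⊤) (n := ⊤) (hU p) (hV p) (by simp)

variable [FiniteDimensional ℝ E] {h : BilinField E L}
  {η : CovectorField E L} {ξ : ∀ p : L, TangentSpace 𝓘(ℝ, E) p}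

namespace IsUnitClosedForm

variable (H : IsUnitClosedForm h η ξ)

include H

theorem contMDiff_metric {U V : ∀ q : L, TangentSpace 𝓘(ℝ, E) q}
    (hU : IsSmoothField U) (hV : IsSmoothField V) : ContMDiff 𝓘(ℝ, E) 𝓘(ℝ, ℝ) ∞
      (fun q => bilinAt h q (vecAt q (U q)) (vecAt q (V q))) := by
  intro p
  have h1 : ContMDiffAt 𝓘(ℝ, E) 𝓘(ℝ, E →L[ℝ] E →L[ℝ] ℝ) ∞
      (metricInChart h p ∘ extChartAt 𝓘(ℝ, E) p) p :=
    ContMDiffAt.comp (I' := 𝓘(ℝ, E)) p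
      (contMDiffAt_iff_contDiffAt.2 (H.metric_contDiffAt p _ (mem_extChartAt_target p)))
      (contMDiffAt_extChartAt (I := 𝓘(ℝ, E)))
  refine ((h1.clm_apply (contMDiffAt_comps (f := fun q => q) (x := p) (hU p) continuousAt_id
    (by simp))).clm_apply (contMDiffAt_comps (f := fun q => q) (x := p) (hV p) continuousAt_id
    (by simp))).congr_of_eventuallyEq ?_
  filter_upwards [(chartAt E p).open_source.mem_nhds (mem_chart_source E p)] with q hq
  exact (metricInChart_chart h hq _ _).symm

theorem contMDiff_form {V : ∀ q : L, TangentSpace 𝓘(ℝ, E) q} (hV : IsSmoothField V) :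
    ContMDiff 𝓘(ℝ, E) 𝓘(ℝ, ℝ) ∞ (fun q => covecAt η q (vecAt q (V q))) :=
  (H.contMDiff_metric H.smooth hV).congr fun q => (H.dual q _).symm

/-- `negCovDeriv` uses a different preferred chart at each point, so smoothness is not visible from
its definition; the Lie derivative formula involves no choice of chart. -/
theorem contMDiff_negCovDeriv_self {V : ∀ q : L, TangentSpace 𝓘(ℝ, E) q} (hV : IsSmoothField V) :
    ContMDiff 𝓘(ℝ, E) 𝓘(ℝ, ℝ) ∞
      (fun q => negCovDeriv h η q (vecAt q (V q)) (vecAt q (V q))) := by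
  have : CompleteSpace E := FiniteDimensional.complete ℝ E
  have h1 := contMDiff_dMap_apply (H.contMDiff_metric hV hV) H.smooth
  have h2 := H.contMDiff_metric (H.smooth.mlieBracket hV) hV
  exact ((contMDiff_const.mul h1).add h2).congr fun q => H.negCovDeriv_self_eq_lie q (hV q)

theorem negCovDeriv_sub_smul_left (p : L) (u v : E) (c : ℝ) :
    negCovDeriv h η p (u - c • vecAt p (ξ p)) v = negCovDeriv h η p u v := by
  have h0 := H.negCovDeriv_rigged p v
  rw [H.negCovDeriv_symm] at h0
  unfold negCovDeriv at h0 ⊢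
  -- `negCovDeriv` is not bundled as a bilinear map; the Koszul expression makes linearity available
  -- to `map_sub` and `map_smul`.
  rw [H.form_christoffel] at h0 ⊢
  rw [H.form_christoffel]
  simp only [map_sub, map_smul, sub_apply, smul_apply, smul_eq_mul] at h0 ⊢
  linear_combination - c * h0

/-- T annihilates ξ in both slots, so it is known once it is known on ker η, that is, on the tangent
spaces of the leaves. -/
theorem negCovDeriv_proj (p : L) (u v : E) :
    negCovDeriv h η p (u - covecAt η p u • vecAt p (ξ p)) (v - covecAt η p v • vecAt p (ξ p)) =
      negCovDeriv h η p u v := by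
  rw [H.negCovDeriv_sub_smul_left, H.negCovDeriv_symm, H.negCovDeriv_sub_smul_left,
    H.negCovDeriv_symm]

theorem form_proj (p : L) (u : E) :
    covecAt η p (u - covecAt η p u • vecAt p (ξ p)) = 0 := by
  rw [map_sub, map_smul, H.unit, smul_eq_mul, mul_one, sub_self]

theorem metric_proj (p : L) (u v : E) :
    bilinAt h p (u - covecAt η p u • vecAt p (ξ p)) (v - covecAt η p v • vecAt p (ξ p)) =
      bilinAt h p u v - covecAt η p u * covecAt η p v := by
  have h1 := H.dual p v
  have h2 := H.dual p u
  have h3 := H.dual p (vecAt p (ξ p))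
  rw [H.unit] at h3
  rw [H.symm] at h2
  simp only [map_sub, map_smul, sub_apply, smul_apply, smul_eq_mul, h1, h2, h3]
  ring

/-- The form is parallel exactly when the field is. -/
theorem negCovDeriv_eq_zero_iff_covAlong_eq_zero :
    (∀ p (u v : E), negCovDeriv h η p u v = 0) ↔
      ∀ (p : L) (w : TangentSpace 𝓘(ℝ, E) p), covAlong h (fun q : L => q) ξ p w = 0 := by
  refine ⟨fun hN p w => H.nondegenerate p _ fun v => ?_, fun hc p u v => ?_⟩
  · exact (H.metric_covAlong_rigged p w v).trans (neg_eq_zero.2 (hN p w v))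
  · have h1 := H.metric_covAlong_rigged p u v
    have h2 : vecAt p (covAlong h (fun q : L => q) ξ p u) = 0 := hc p u
    rw [h2, map_zero, zero_apply] at h1
    linarith

/-- A function `ρ` with `-∇η = ρ (h - η ⊗ η)` is smooth near a point at which `ker η` is
nontrivial. -/
theorem contMDiffAt_of_negCovDeriv_eq [T2Space L] {ρ : L → ℝ}
    (hρ : ∀ p (u v : E), negCovDeriv h η p u v =
      ρ p * (bilinAt h p u v - covecAt η p u * covecAt η p v))
    {p : L} {w : E} (hw : w ≠ 0) (hηw : covecAt η p w = 0) :
    ContMDiffAt 𝓘(ℝ, E) 𝓘(ℝ, ℝ) ∞ ρ p := by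
  obtain ⟨W, hW, hWp⟩ := exists_smoothField_eq p (show TangentSpace 𝓘(ℝ, E) p from w)
  -- The denominator of ρ = T(W, W) / m. At `p` it equals h(w, w), since η(w) = 0, so it stays
  -- nonzero nearby.
  let m : L → ℝ := fun q => bilinAt h q (vecAt q (W q)) (vecAt q (W q)) -
    covecAt η q (vecAt q (W q)) * covecAt η q (vecAt q (W q))
  have hm : ContMDiff 𝓘(ℝ, E) 𝓘(ℝ, ℝ) ∞ m :=
    (H.contMDiff_metric hW hW).sub ((H.contMDiff_form hW).mul (H.contMDiff_form hW))
  have hWp' : vecAt p (W p) = w := hWp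
  have hmp : m p ≠ 0 := by
    simp only [m, hWp', hηw, mul_zero, sub_zero]
    exact (H.pos p w hw).ne'
  refine ((H.contMDiff_negCovDeriv_self hW p).div₀ (hm p) hmp).congr_of_eventuallyEq ?_
  filter_upwards [(hm p).continuousAt.eventually_ne hmp] with q hq
  exact (eq_div_iff hq).2 (hρ q _ _).symm

end IsUnitClosedForm

end Smoothness

/-! ### Second fundamental forms of the leaves. -/

namespace IsUnitClosedForm

universe v

variable {n : ℕ} {L : Type v} [TopologicalSpace L]
  [ChartedSpace (EuclideanSpace ℝ (Fin (n + 1))) L] [IsManifold (𝓡 (n + 1)) ∞ L]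
  {h : BilinField (EuclideanSpace ℝ (Fin (n + 1))) L}
  {η : CovectorField (EuclideanSpace ℝ (Fin (n + 1))) L} {ξ : ∀ p : L, TangentSpace (𝓡 (n + 1)) p}
  (H : IsUnitClosedForm h η ξ)
  (P : IntegralManifold (L := L) fun p => LinearMap.ker (η p).toLinearMap)

theorem mem_tangentRange_incl_iff (s : P.S) (a : EuclideanSpace ℝ (Fin (n + 1))) :
    a ∈ tangentRange (F := EuclideanSpace ℝ (Fin n)) P.incl s ↔ covecAt η (P.incl s) a = 0 := by
  rw [P.tangent s]
  rfl

theorem form_dMap_incl (s : P.S) (w : EuclideanSpace ℝ (Fin n)) :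
    covecAt η (P.incl s) (dMap P.incl s w) = 0 :=
  (mem_tangentRange_incl_iff P s _).1 ⟨w, rfl⟩

include H

theorem isNormalAt_smul (s : P.S) (c : ℝ) :
    IsNormalAt (F := EuclideanSpace ℝ (Fin n)) h P.incl s (c • ξ (P.incl s)) := by
  intro a ha
  have h1 : bilinAt h (P.incl s) (c • vecAt _ (ξ (P.incl s))) (vecAt _ a) = 0 := by
    have h2 : covecAt η (P.incl s) (vecAt _ a) = 0 := (mem_tangentRange_incl_iff P s _).1 ha
    rw [map_smul, smul_apply, H.dual, h2, smul_zero]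
  exact h1

/-- The difference lies in ker η, the tangent space, and is also normal, so positivity forces it to
vanish. -/
theorem eq_of_isNormalAt (s : P.S) {a b : EuclideanSpace ℝ (Fin (n + 1))}
    (ha : IsNormalAt (F := EuclideanSpace ℝ (Fin n)) h P.incl s a)
    (hb : IsNormalAt (F := EuclideanSpace ℝ (Fin n)) h P.incl s b)
    (hab : covecAt η (P.incl s) a = covecAt η (P.incl s) b) : a = b := by
  have hmem := (mem_tangentRange_incl_iff P s (a - b)).2 (by rw [map_sub, hab, sub_self])
  have h1 : bilinAt h (P.incl s) a (a - b) = 0 := ha _ hmem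
  have h2 : bilinAt h (P.incl s) b (a - b) = 0 := hb _ hmem
  by_contra h0
  refine (H.pos (P.incl s) (a - b) (sub_ne_zero.2 h0)).ne' ?_
  rw [map_sub (bilinAt h (P.incl s)), sub_apply, h1, h2, sub_zero]

/-- The normal line is spanned by ξ with η(ξ) = 1, so the normal part of ∇_X Y is η(∇_X Y) ξ; and
η(Y) = 0 turns η(∇_X Y) into T(X, Y). -/
theorem secondFundForm_eq (X : ∀ s : P.S, TangentSpace (𝓡 n) s)
    {Y : ∀ s : P.S, TangentSpace (𝓡 n) s} (hY : IsSmoothField Y) (s : P.S) :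
    vecAt _ (secondFundForm h P.incl X Y s) =
      negCovDeriv h η (P.incl s) (vecAt _ (pushField P.incl X s))
        (vecAt _ (pushField P.incl Y s)) • vecAt _ (ξ (P.incl s)) := by
  have hi := P.immersion.contMDiff
  set k := negCovDeriv h η (P.incl s) (vecAt _ (pushField P.incl X s))
    (vecAt _ (pushField P.incl Y s))
  set W := vecAt (P.incl s) (covAlong h P.incl (pushField P.incl Y) s (X s))
  have hcov : covecAt η (P.incl s) W = k := H.form_covAlong hi (contMDiff_pushField hi hY)
    (fun q => form_dMap_incl P q _) s _
  have hk : covecAt η (P.incl s) (k • vecAt _ (ξ (P.incl s))) = k := by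
    rw [map_smul, H.unit, smul_eq_mul, mul_one]
  have hWk : covecAt η (P.incl s) (W - k • vecAt _ (ξ (P.incl s))) = 0 := by
    rw [map_sub, hcov, hk, sub_self]
  -- The explicit normal vector `k • ξ` shows that the `epsilon` is no default value; uniqueness of
  -- the normal part then identifies the two.
  have hspec := Classical.epsilon_spec (p := fun z =>
    IsNormalAt (F := EuclideanSpace ℝ (Fin n)) h P.incl s z ∧
      covAlong h P.incl (pushField P.incl Y) s (X s) - z ∈
        tangentRange (F := EuclideanSpace ℝ (Fin n)) P.incl s)
    ⟨k • ξ (P.incl s), H.isNormalAt_smul P s k, (mem_tangentRange_incl_iff P s _).2 hWk⟩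
  refine H.eq_of_isNormalAt P s hspec.1 (H.isNormalAt_smul P s k) ?_
  have hz : covecAt η (P.incl s) (W - vecAt _ (secondFundForm h P.incl X Y s)) = 0 :=
    (mem_tangentRange_incl_iff P s _).1 hspec.2
  rw [map_sub, hcov, sub_eq_zero] at hz
  exact hz.symm.trans hk.symm

variable [T2Space L]

omit H in
/-- Tangent vectors of the integral manifold are the values of its smooth vector fields. -/
theorem exists_smoothField_pushField_eq (s : P.S) {u : EuclideanSpace ℝ (Fin (n + 1))}
    (hu : covecAt η (P.incl s) u = 0) : ∃ X : ∀ s : P.S, TangentSpace (𝓡 n) s,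
      IsSmoothField X ∧ vecAt (P.incl s) (pushField P.incl X s) = u := by
  have : T2Space P.S := T2Space.of_injective_continuous P.injective P.immersion.contMDiff.continuous
  obtain ⟨w, hw⟩ := (mem_tangentRange_incl_iff P s u).2 hu
  obtain ⟨X, hX, hXs⟩ := exists_smoothField_eq s w
  refine ⟨X, hX, ?_⟩
  rw [← hw, ← hXs]
  rfl

/-- Every point lies on a leaf of `ker η`. -/
theorem exists_leaf (p : L) :
    ∃ (Q : IntegralManifold (L := L) fun p => LinearMap.ker (η p).toLinearMap) (s : Q.S), Q.IsLeaf ∧ Q.incl s = p := by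
  obtain ⟨s, hs⟩ := H.mem_range_leafThrough p
  exact ⟨H.leafThrough p, s, H.isLeaf_leafThrough p, hs⟩

/-- Vanishing on leaves is vanishing of T on ker η, which is vanishing of T. Only the forward
direction needs a leaf through every point. -/
theorem forall_leaf_totallyGeodesic_iff :
    (∀ P : IntegralManifold (L := L) fun p => LinearMap.ker (η p).toLinearMap, P.IsLeaf →
      IsTotallyGeodesic (EuclideanSpace ℝ (Fin n)) h P.incl) ↔
    ∀ p (u v : EuclideanSpace ℝ (Fin (n + 1))), negCovDeriv h η p u v = 0 := by
  refine ⟨fun hP p u v => ?_, fun hN P _ X Y _ hY s => ?_⟩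
  · rw [← H.negCovDeriv_proj]
    obtain ⟨Q, s, hQ, rfl⟩ := H.exists_leaf p
    obtain ⟨X, hX, hXs⟩ := exists_smoothField_pushField_eq Q s (H.form_proj _ u)
    obtain ⟨Y, hY, hYs⟩ := exists_smoothField_pushField_eq Q s (H.form_proj _ v)
    have h1 : negCovDeriv h η (Q.incl s) (vecAt _ (pushField Q.incl X s))
        (vecAt _ (pushField Q.incl Y s)) • vecAt _ (ξ (Q.incl s)) =
          (0 : EuclideanSpace ℝ (Fin (n + 1))) :=
      (H.secondFundForm_eq Q X hY s).symm.trans (hP Q hQ X Y hX hY s)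
    have h2 := congrArg (covecAt η (Q.incl s)) h1
    rwa [hXs, hYs, map_smul, map_zero, H.unit, smul_eq_mul, mul_one] at h2
  · have h1 : negCovDeriv h η (P.incl s) (vecAt _ (pushField P.incl X s))
        (vecAt _ (pushField P.incl Y s)) • vecAt _ (ξ (P.incl s)) =
          (0 : EuclideanSpace ℝ (Fin (n + 1))) := by rw [hN, zero_smul]
    exact (H.secondFundForm_eq P X hY s).trans h1

/-- The coefficient is η(Z) on a leaf through the point, with no control from one leaf to the next.
Projecting to ker η replaces h by h - η⊗η. -/
theorem exists_coefficient_of_leaf_totallyUmbilic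
    (hP : ∀ P : IntegralManifold (L := L) fun p => LinearMap.ker (η p).toLinearMap, P.IsLeaf →
      IsTotallyUmbilic (EuclideanSpace ℝ (Fin n)) h P.incl) (p : L) :
    ∃ r : ℝ, ∀ u v : EuclideanSpace ℝ (Fin (n + 1)), negCovDeriv h η p u v =
      r * (bilinAt h p u v - covecAt η p u * covecAt η p v) := by
  obtain ⟨Q, s, hQ, rfl⟩ := H.exists_leaf p
  obtain ⟨Z, -, -, hZ⟩ := hP Q hQ
  refine ⟨covecAt η (Q.incl s) (vecAt _ (Z s)), fun u v => ?_⟩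
  rw [← H.negCovDeriv_proj, ← H.metric_proj]
  obtain ⟨X, hX, hXs⟩ := exists_smoothField_pushField_eq Q s (H.form_proj _ u)
  obtain ⟨Y, hY, hYs⟩ := exists_smoothField_pushField_eq Q s (H.form_proj _ v)
  have h1 : negCovDeriv h η (Q.incl s) (vecAt _ (pushField Q.incl X s))
      (vecAt _ (pushField Q.incl Y s)) • vecAt _ (ξ (Q.incl s)) =
        bilinAt h (Q.incl s) (vecAt _ (pushField Q.incl X s))
          (vecAt _ (pushField Q.incl Y s)) • vecAt _ (Z s) :=
    (H.secondFundForm_eq Q X hY s).symm.trans (hZ X Y hX hY s)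
  have h2 := congrArg (covecAt η (Q.incl s)) h1
  rw [hXs, hYs, map_smul, map_smul, H.unit, smul_eq_mul, smul_eq_mul, mul_one] at h2
  rw [h2, mul_comm]

theorem forall_leaf_totallyUmbilic_iff :
    (∀ P : IntegralManifold (L := L) fun p => LinearMap.ker (η p).toLinearMap, P.IsLeaf →
      IsTotallyUmbilic (EuclideanSpace ℝ (Fin n)) h P.incl) ↔
    ∃ ρ : L → ℝ, ContMDiff (𝓡 (n + 1)) 𝓘(ℝ, ℝ) ∞ ρ ∧
      ∀ p (u v : EuclideanSpace ℝ (Fin (n + 1))), negCovDeriv h η p u v =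
        ρ p * (bilinAt h p u v - covecAt η p u * covecAt η p v) := by
  refine ⟨fun hP => ?_, ?_⟩
  · choose ρ hρ using H.exists_coefficient_of_leaf_totallyUmbilic hP
    -- For n = 0 the chosen `ρ` is unconstrained, hence possibly not smooth, but ker η = 0 makes
    -- both sides vanish and 0 serves.
    rcases Nat.eq_zero_or_pos n with h0 | hn
    · refine ⟨fun _ => 0, contMDiff_const, fun p u v => ?_⟩
      have hu : u - covecAt η p u • vecAt p (ξ p) = 0 := by
        have hker := Submodule.finrank_eq_zero.1 ((H.finrank_ker_form p).trans h0)
        have hmem : u - covecAt η p u • vecAt p (ξ p) ∈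
            LinearMap.ker (covecAt η p).toLinearMap := H.form_proj p u
        rwa [hker, Submodule.mem_bot] at hmem
      rw [hρ, ← H.metric_proj, hu, map_zero, zero_apply, mul_zero, mul_zero]
    · refine ⟨ρ, fun p => ?_, hρ⟩
      have hker : LinearMap.ker (covecAt η p).toLinearMap ≠ ⊥ := fun hbot => by
        have := H.finrank_ker_form p
        rw [hbot, finrank_bot] at this
        omega
      obtain ⟨w, hw, hw0⟩ := Submodule.exists_mem_ne_zero_of_ne_bot hker
      exact H.contMDiffAt_of_negCovDeriv_eq hρ hw0 hw
  · rintro ⟨ρ, hρ, hN⟩ P -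
    have hsm : IsSmoothField (ρ • ξ) := hρ.smul_section H.smooth
    -- The umbilicity normal field is ρ ξ restricted to the leaf; η vanishes on tangent vectors, so
    -- h - η⊗η reduces to h there.
    refine ⟨fun s => ρ (P.incl s) • ξ (P.incl s), hsm.comp P.immersion.contMDiff,
      fun s => H.isNormalAt_smul P s _, fun X Y _ hY s => ?_⟩
    have h1 : negCovDeriv h η (P.incl s) (vecAt _ (pushField P.incl X s))
        (vecAt _ (pushField P.incl Y s)) • vecAt _ (ξ (P.incl s)) =
        bilinAt h (P.incl s) (vecAt _ (pushField P.incl X s))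
          (vecAt _ (pushField P.incl Y s)) • (ρ (P.incl s) • vecAt _ (ξ (P.incl s))) := by
      have h2 : covecAt η (P.incl s) (vecAt _ (pushField P.incl X s)) = 0 := form_dMap_incl P s _
      rw [hN, h2, zero_mul, sub_zero, smul_smul, mul_comm]
    exact (H.secondFundForm_eq P X hY s).trans h1

end IsUnitClosedForm

/-! ### Conditions on B as conditions on -∇̃ω. -/

namespace Rigging

universe u v

variable {n : ℕ} {M : Type u} [TopologicalSpace M]
  [ChartedSpace (EuclideanSpace ℝ (Fin (n + 2))) M] [IsManifold (𝓡 (n + 2)) ∞ M]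
  {L : Type v} [TopologicalSpace L] [ChartedSpace (EuclideanSpace ℝ (Fin (n + 1))) L]
  [IsManifold (𝓡 (n + 1)) ∞ L] [T2Space L]
  {g : LorentzianMetric (EuclideanSpace ℝ (Fin (n + 2))) M} {i : L → M}
  (hL : IsLightlikeHypersurface g i) (ζ : Rigging n i) (hζ : ζ.IsClosed g)

include hL hζ

theorem totallyGeodesic_iff : ζ.TotallyGeodesic g ↔
    ∀ p (u v : EuclideanSpace ℝ (Fin (n + 1))),
      negCovDeriv (ζ.riggedMetric g) (ζ.omega g) p u v = 0 := by
  refine ⟨fun hB p u v => ?_, fun hN U V _ hV p => ?_⟩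
  · obtain ⟨U, hU, rfl⟩ := exists_smoothField_eq p (show TangentSpace (𝓡 (n + 1)) p from u)
    obtain ⟨V, hV, rfl⟩ := exists_smoothField_eq p (show TangentSpace (𝓡 (n + 1)) p from v)
    exact (ζ.lightlikeB_eq hL hζ U hV p).symm.trans (hB U V hU hV p)
  · rw [ζ.lightlikeB_eq hL hζ U hV, hN]

/-- The metric induced by g is g̃ - ω⊗ω, so B = ρ g is the stated condition on T; extending vectors
to fields passes between the pointwise and field forms. -/
theorem totallyUmbilic_iff : ζ.TotallyUmbilic g ↔
    ∃ ρ : L → ℝ, ContMDiff (𝓡 (n + 1)) 𝓘(ℝ, ℝ) ∞ ρ ∧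
      ∀ p (u v : EuclideanSpace ℝ (Fin (n + 1))),
        negCovDeriv (ζ.riggedMetric g) (ζ.omega g) p u v =
          ρ p * (bilinAt (ζ.riggedMetric g) p u v -
            covecAt (ζ.omega g) p u * covecAt (ζ.omega g) p v) := by
  refine exists_congr fun ρ => and_congr_right fun _ => ⟨fun hB p u v => ?_, fun hN U V _ hV p => ?_⟩
  · rw [riggedMetric_apply, add_sub_cancel_right]
    obtain ⟨U, hU, rfl⟩ := exists_smoothField_eq p (show TangentSpace (𝓡 (n + 1)) p from u)
    obtain ⟨V, hV, rfl⟩ := exists_smoothField_eq p (show TangentSpace (𝓡 (n + 1)) p from v)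
    exact (ζ.lightlikeB_eq hL hζ U hV p).symm.trans (hB U V hU hV p)
  · rw [ζ.lightlikeB_eq hL hζ U hV, hN, riggedMetric_apply, add_sub_cancel_right]
    rfl

end Rigging

end LightlikeRigging

end

/-! ### The main theorem. -/

theorem mainTheorem12 (n : ℕ)
    {M : Type*} [TopologicalSpace M] [T2Space M]
    [ChartedSpace (EuclideanSpace ℝ (Fin (n + 2))) M] [IsManifold (𝓡 (n + 2)) ∞ M]
    {L : Type*} [TopologicalSpace L]
    [ChartedSpace (EuclideanSpace ℝ (Fin (n + 1))) L] [IsManifold (𝓡 (n + 1)) ∞ L]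
    (g : LightlikeRigging.LorentzianMetric (EuclideanSpace ℝ (Fin (n + 2))) M)
    (i : L → M) (hL : LightlikeRigging.IsLightlikeHypersurface g i)
    (ζ : LightlikeRigging.Rigging n i) (hζ : ζ.IsClosed g) :
    (ζ.TotallyGeodesic g ↔ ζ.RiggedIsParallel g) ∧
    (ζ.TotallyGeodesic g ↔
      ∀ P : LightlikeRigging.IntegralManifold (ζ.screen g), P.IsLeaf →
        LightlikeRigging.IsTotallyGeodesic (EuclideanSpace ℝ (Fin n))
          (ζ.riggedMetric g) P.incl) ∧
    (ζ.TotallyUmbilic g ↔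
      ∀ P : LightlikeRigging.IntegralManifold (ζ.screen g), P.IsLeaf →
        LightlikeRigging.IsTotallyUmbilic (EuclideanSpace ℝ (Fin n))
          (ζ.riggedMetric g) P.incl) := by
  -- `L` inherits the Hausdorff property through the continuous injection `i`; the bump functions
  -- that extend tangent vectors to fields rely on it.
  have : T2Space L := T2Space.of_injective_continuous hL.injective hL.contMDiff.continuous
  have H := ζ.isUnitClosedForm hL hζ
  exact ⟨(ζ.totallyGeodesic_iff hL hζ).trans H.negCovDeriv_eq_zero_iff_covAlong_eq_zero,
    (ζ.totallyGeodesic_iff hL hζ).trans H.forall_leaf_totallyGeodesic_iff.symm,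
    (ζ.totallyUmbilic_iff hL hζ).trans H.forall_leaf_totallyUmbilic_iff.symm⟩
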